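/- Let $p$ be a prime and let $F$ be a non-archimedean local field (a complete discretely valued field with finite residue field) of residue characteristic $p$, with ring of integers $\mathcal{O}$ and a fixed uniformizer $\varpi$. Let $\overline{\mathbb{F}}_p$ denote a fixed algebraically closed field of characteristic $p$. Put $G=\mathrm{GL}_2(F)$, $K=\mathrm{GL}_2(\mathcal{O})$, let $Z$ be the centre of $G$, and put $$\Pi=\begin{pmatrix}0&1\\ \varpi&0\end{pmatrix},\qquad P^+=\left\{\begin{pmatrix}a&b\\0&1\end{pmatrix}: a\in\mathcal{O}\setminus\{0\},\ b\in\mathcal{O}\right\}.$$ A weight is a smooth irreducible representation $\sigma$ of $KZ$ over $\overline{\mathbb{F}}_p$ (smooth: every vector is fixed by an open subgroup). Let $\mathrm{c\text{-}Ind}_{KZ}^G\sigma$ be the space of locally constant functions $f:G\to\sigma$, with compact support modulo $KZ$, such that $f(hg)=h\cdot f(g)$ for $h\in KZ$, $g\in G$, with $G$ acting by $(g'f)(g)=f(gg')$. For $g\in G$ and $v\in\sigma$ let $[g,v]\in\mathrm{c\text{-}Ind}_{KZ}^G\sigma$ be the function supported on $KZg^{-1}$ with value $v$ at $g^{-1}$.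 Let $I^+(\sigma)$ be the subspace spanned by the $[g,v]$ with $g\in P^+$, $v\in\sigma$, and let $I^-(\sigma)=\Pi\cdot I^+(\sigma)$. Let $\sigma$ be a weight, let $\mathrm{c\text{-}Ind}_{KZ}^G\sigma\twoheadrightarrow\pi$ be a nontrivial $G$-equivariant quotient, meaning that its kernel $R(\sigma,\pi)$ is nonzero, let $I^{+}(\sigma,\pi)$ and $I^{-}(\sigma,\pi)$ be the images of $I^{+}(\sigma)$ and $I^{-}(\sigma)$ in $\pi$, and let $D_1(\sigma,\pi)=I^+(\sigma,\pi)\cap I^-(\sigma,\pi)$. Then the following are equivalent: (i) $D_1(\sigma,\pi)$ is a finite-dimensional $\overline{\mathbb{F}}_p$-vector space; (ii) $R(\sigma,\pi)$ is finitely generated as an $\overline{\mathbb{F}}_p[G]$-module. -/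

import Mathlib

open scoped MonoidAlgebra ValuativeRel

noncomputable section

namespace ModpGL2

section General

variable {k G V : Type*} [Field k] [Group G] [TopologicalSpace G] [AddCommGroup V] [Module k V]

/-- A representation of a topological group is smooth if every vector is fixed by some open
subgroup. -/
def IsSmooth (ρ : Representation k G V) : Prop :=
  ∀ v : V, ∃ U : Subgroup G, IsOpen (U : Set G) ∧ ∀ u ∈ U, ρ u v = v

variable (H : Subgroup G) (σ : Representation k H V)

/-- The space of the compact induction `cInd_H^G σ`: the locally constant functions `f : G → V`
with compact support modulo `H` (the support lies in `H * C` for some compact set `C`) such that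
`f (h * g) = σ h (f g)` for `h` in `H` and `g` in `G`. -/
def cIndSpace [ContinuousMul G] : Submodule k (G → V) where
  carrier := {f | IsLocallyConstant f ∧
    (∃ C : Set G, IsCompact C ∧ ∀ g : G, f g ≠ 0 → ∃ h ∈ H, ∃ c ∈ C, g = h * c) ∧
    ∀ (h : H) (g : G), f (h * g) = σ h (f g)}
  zero_mem' := ⟨IsLocallyConstant.const 0, ⟨∅, isCompact_empty, fun _ hg => absurd rfl hg⟩,
    fun h _ => (map_zero (σ h)).symm⟩
  add_mem' := by
    rintro f₁ f₂ ⟨l₁, ⟨C₁, hC₁, s₁⟩, e₁⟩ ⟨l₂, ⟨C₂, hC₂, s₂⟩, e₂⟩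
    refine ⟨l₁.add l₂, ⟨C₁ ∪ C₂, hC₁.union hC₂, fun g hg => ?_⟩, fun h g => ?_⟩
    · by_cases h₁ : f₁ g = 0
      · have h₂ : f₂ g ≠ 0 := fun h₂ => hg (by simp [h₁, h₂])
        obtain ⟨h, hh, c, hc, rfl⟩ := s₂ g h₂
        exact ⟨h, hh, c, Or.inr hc, rfl⟩
      · obtain ⟨h, hh, c, hc, rfl⟩ := s₁ g h₁
        exact ⟨h, hh, c, Or.inl hc, rfl⟩
    · simp [e₁, e₂]
  smul_mem' := by
    rintro a f ⟨l, ⟨C, hC, s⟩, e⟩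
    refine ⟨l.comp (fun x => a • x), ⟨C, hC, fun g hg => s g fun h => hg (by simp [h])⟩,
      fun h g => ?_⟩
    simp [e]

/-- The representation of `G` on `cInd_H^G σ` by right translation, `(g' • f) g = f (g * g')`. -/
def cInd [ContinuousMul G] : Representation k G (cIndSpace H σ) where
  toFun g' :=
    { toFun := fun f => ⟨fun g => f.1 (g * g'), by
        obtain ⟨f, l, ⟨C, hC, s⟩, e⟩ := f
        refine ⟨l.comp_continuous (continuous_mul_const g'),
          ⟨(fun x => x * g'⁻¹) '' C, hC.image (continuous_mul_const g'⁻¹), fun g hg => ?_⟩,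
          fun h g => ?_⟩
        · obtain ⟨h, hh, c, hc, hgc⟩ := s _ hg
          refine ⟨h, hh, c * g'⁻¹, ⟨c, hc, rfl⟩, ?_⟩
          rw [← mul_assoc, ← hgc, mul_inv_cancel_right]
        · show f (h * g * g') = σ h (f (g * g'))
          rw [mul_assoc, e]⟩
      map_add' := fun _ _ => rfl
      map_smul' := fun _ _ => rfl }
  map_one' := by
    ext f g
    simp
  map_mul' g₁ g₂ := by
    ext f g
    simp [mul_assoc]

open Classical in
/-- The function `[g, v] : G → V` with support in `H * g⁻¹` and with value `v` at `g⁻¹`, that is,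
`[g, v] (h * g⁻¹) = σ h v` for `h` in `H`. -/
def bracket (g : G) (v : V) : G → V :=
  fun x => if hx : x * g ∈ H then σ ⟨x * g, hx⟩ v else 0

/-- If `H` is open and `σ` is smooth, the functions `[g, v]` lie in `cInd_H^G σ`. -/
theorem bracket_mem [ContinuousMul G] (hH : IsOpen (H : Set G)) (hσ : IsSmooth σ) (g : G) (v : V) :
    bracket H σ g v ∈ cIndSpace H σ := by
  refine ⟨?_, ⟨{g⁻¹}, isCompact_singleton, fun x hx => ?_⟩, fun h x => ?_⟩
  · rw [IsLocallyConstant.iff_exists_open]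
    intro x
    obtain ⟨U, hU, hUv⟩ := hσ v
    refine ⟨(fun y => (x * g)⁻¹ * (y * g)) ⁻¹' (Subtype.val '' (U : Set H)),
      (hH.isOpenMap_subtype_val _ hU).preimage (by fun_prop), ⟨1, U.one_mem, by simp⟩, ?_⟩
    rintro y ⟨u, hu, hy⟩
    have hy' : y * g = x * g * u := by
      rw [show (u : G) = (x * g)⁻¹ * (y * g) from hy, mul_inv_cancel_left]
    by_cases hm : x * g ∈ H
    · have hm' : y * g ∈ H := hy' ▸ H.mul_mem hm u.2
      have : (⟨y * g, hm'⟩ : H) = ⟨x * g, hm⟩ * u := Subtype.ext hy'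
      simp [bracket, hm, hm', this, hUv u hu]
    · have hm' : y * g ∉ H := by
        rw [hy']; exact fun hc => hm ((H.mul_mem_cancel_right u.2).1 hc)
      simp [bracket, hm, hm']
  · by_cases hm : x * g ∈ H
    · exact ⟨x * g, hm, g⁻¹, rfl, by simp⟩
    · exact absurd (by simp [bracket, hm]) hx
  · by_cases hm : x * g ∈ H
    · have hm' : (h : G) * x * g ∈ H := by rw [mul_assoc]; exact H.mul_mem h.2 hm
      have : (⟨(h : G) * x * g, hm'⟩ : H) = h * ⟨x * g, hm⟩ := Subtype.ext (mul_assoc _ _ _)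
      simp [bracket, hm, hm', this]
    · have hm' : (h : G) * x * g ∉ H := by
        rw [mul_assoc]; exact fun hc => hm ((H.mul_mem_cancel_left h.2).1 hc)
      simp [bracket, hm, hm']

end General

section GL2

variable (F : Type*) [Field F] [ValuativeRel F]

/-- The maximal compact subgroup `K = GL₂(𝒪)` of `GL₂(F)`. -/
def K : Subgroup (GL (Fin 2) F) :=
  (Matrix.GeneralLinearGroup.map (n := Fin 2) (algebraMap 𝒪[F] F)).range

/-- The subgroup `KZ`, with `Z` the centre of `GL₂(F)`. -/
def KZ : Subgroup (GL (Fin 2) F) := K F ⊔ Subgroup.center (GL (Fin 2) F)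

/-- `P⁺`, the set of the matrices `(a b; 0 1)` with `a` in `𝒪 \ {0}` and `b` in `𝒪`. -/
def PPlus : Set (GL (Fin 2) F) :=
  {g : GL (Fin 2) F | ∃ a b : 𝒪[F], a ≠ 0 ∧ (g : Matrix (Fin 2) (Fin 2) F) = !![(a : F), (b : F); 0, 1]}

variable {F}

/-- The matrix `Π = (0 1; ϖ 0)` attached to a uniformizer `ϖ`. -/
def Pi (ϖ : 𝒪[F]) (hϖ : Irreducible ϖ) : GL (Fin 2) F :=
  Matrix.GeneralLinearGroup.mkOfDetNeZero !![0, 1; (ϖ : F), 0] (by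
    simpa [Matrix.det_fin_two] using hϖ.ne_zero)

variable [TopologicalSpace F] {k V W : Type*} [Field k]
  [AddCommGroup V] [Module k V] [AddCommGroup W] [Module k W]

/-- A weight: a smooth irreducible representation of `KZ`. -/
structure IsWeight (σ : Representation k (KZ F) V) : Prop where
  smooth : IsSmooth σ
  irreducible : σ.IsIrreducible

/-- The subgroup `KZ` is open, so that the functions `[g, v]` lie in `cInd_{KZ}^G σ` for every
weight `σ`. -/
theorem isOpen_KZ [IsNonarchimedeanLocalField F] : IsOpen (KZ F : Set (GL (Fin 2) F)) := by
  have hO : IsOpen {x : F | x ∈ 𝒪[F]} := by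
    let := IsTopologicalAddGroup.rightUniformSpace F
    have := isUniformAddGroup_of_addCommGroup (G := F)
    exact Valued.isOpen_integer F
  have hK : IsOpen (K F : Set (GL (Fin 2) F)) := by
    have hset : (K F : Set (GL (Fin 2) F)) =
        {g : GL (Fin 2) F | ∀ i j, (g : Matrix (Fin 2) (Fin 2) F) i j ∈ 𝒪[F] ∧
          ((g⁻¹ : GL (Fin 2) F) : Matrix (Fin 2) (Fin 2) F) i j ∈ 𝒪[F]} := by
      ext g
      constructor
      · rintro ⟨x, rfl⟩ i j
        rw [← map_inv]
        exact ⟨(x i j).2, ((x⁻¹ : GL (Fin 2) 𝒪[F]) i j).2⟩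
      · intro h
        have hinj : Function.Injective ((algebraMap 𝒪[F] F).mapMatrix (m := Fin 2)) :=
          Matrix.map_injective Subtype.val_injective
        let A : Matrix (Fin 2) (Fin 2) 𝒪[F] := Matrix.of fun i j => ⟨_, (h i j).1⟩
        let B : Matrix (Fin 2) (Fin 2) 𝒪[F] := Matrix.of fun i j => ⟨_, (h i j).2⟩
        have hA : (algebraMap 𝒪[F] F).mapMatrix A = g.val := rfl
        have hB : (algebraMap 𝒪[F] F).mapMatrix B = g⁻¹.val := rfl
        refine ⟨⟨A, B, hinj ?_, hinj ?_⟩, Units.ext rfl⟩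
        · rw [map_mul, map_one, hA, hB, Units.mul_inv]
        · rw [map_mul, map_one, hA, hB, Units.inv_mul]
    rw [hset]
    simp only [Set.ofPred_forall, Set.ofPred_and]
    refine isOpen_iInter_of_finite fun i => isOpen_iInter_of_finite fun j => IsOpen.inter ?_ ?_
    · exact hO.preimage ((Units.continuous_val.matrix_elem i j))
    · exact hO.preimage (((Units.continuous_val.comp continuous_inv).matrix_elem i j))
  exact Subgroup.isOpen_mono (le_sup_left : K F ≤ KZ F) hK

variable [IsNonarchimedeanLocalField F] (ϖ : 𝒪[F]) (hϖ : Irreducible ϖ)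
  (σ : Representation k (KZ F) V)

/-- `I⁺(σ)`, the subspace of `cInd_{KZ}^G σ` spanned by the `[g, v]` with `g` in `P⁺`
and `v` in `σ`. -/
def IPlus : Submodule k (cIndSpace (KZ F) σ) :=
  Submodule.span k {f | ∃ g ∈ PPlus F, ∃ v : V, (f : GL (Fin 2) F → V) = bracket (KZ F) σ g v}

/-- `I⁻(σ) = Π · I⁺(σ)`. -/
def IMinus : Submodule k (cIndSpace (KZ F) σ) :=
  (IPlus σ).map (cInd (KZ F) σ (Pi ϖ hϖ))

variable {σ} {π : Representation k (GL (Fin 2) F) W}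
  (φ : Representation.IntertwiningMap (cInd (KZ F) σ) π)

/-- `D₁(σ, π)`, the intersection of the images `I⁺(σ, π)` and `I⁻(σ, π)` in `π` of `I⁺(σ)`
and `I⁻(σ)`. -/
def D1 : Submodule k W :=
  (IPlus σ).map φ.toLinearMap ⊓ (IMinus ϖ hϖ σ).map φ.toLinearMap

/-- `R(σ, π)`, the kernel of `cInd_{KZ}^G σ → π`, as a `k[G]`-module. -/
def R : Submodule k[GL (Fin 2) F] (cInd (KZ F) σ).asModule :=
  φ.ker.asSubmodule

end GL2

end ModpGL2

end

/-!
The cosets `G ⧸ KZ` are the vertices of the Bruhat–Tits tree, and `I⁺`, `I⁻` consist of the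
functions supported on the two half-trees `P`, `Pᶜ` that remain when an edge is removed. Sending a
relation `f ∈ R` to the image in `π` of its restriction to `P` identifies `D₁` with
`R ⧸ ((R ∩ I⁺) + (R ∩ I⁻))`. A ball far from the edge lies in one of the half-trees; so if `R` is
generated by finitely many functions, all but finitely many translates of the generators vanish in
this quotient, and `D₁` is finite-dimensional. Conversely, if `D₁` is finite-dimensional, it lifts
to functions supported in a fixed ball. Subtracting translates of such lifts, any relation is pruned
branch by branch into translates of relations supported in that ball, and these form a
finite-dimensional space.

All this uses only that `σ` is finite-dimensional. For a weight this holds because `KZ` is compact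
modulo the powers of a central element `z`: smoothness makes the space a finite module over the
commutative algebra generated by `σ z` and its inverse, irreducibility and Nakayama's lemma make the
annihilator of this module maximal, and the Nullstellensatz applies.
-/

noncomputable section

namespace ModpGL2

open scoped Pointwise

section Supports

theorem finite_image_of_isLocallyConstant {X Y : Type*} [TopologicalSpace X] {f : X → Y}
    (hf : IsLocallyConstant f) {C : Set X} (hC : IsCompact C) : (f '' C).Finite := by
  let : TopologicalSpace Y := ⊥
  have : DiscreteTopology Y := ⟨rfl⟩
  exact (hC.image hf.continuous).finite_of_discrete

theorem mk_inv_eq_mk_inv_iff {G : Type*} [Group G] {H : Subgroup G} {g g' : G} :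
    ((g⁻¹ : G) : G ⧸ H) = (g'⁻¹ : G) ↔ g * g'⁻¹ ∈ H := by
  rw [QuotientGroup.eq, inv_inv]

variable {k G V : Type*} [Field k] [Group G] [TopologicalSpace G] [ContinuousMul G]
  [AddCommGroup V] [Module k V] {H : Subgroup G} {σ : Representation k H V}

theorem isLocallyConstant_mk_inv (hH : IsOpen (H : Set G)) :
    IsLocallyConstant fun g : G => ((g⁻¹ : G) : G ⧸ H) := by
  rw [IsLocallyConstant.iff_exists_open]
  refine fun g => ⟨(· * g⁻¹) ⁻¹' H, hH.preimage (continuous_mul_const g⁻¹), by simp, ?_⟩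
  exact fun g' hg' => mk_inv_eq_mk_inv_iff.2 hg'

theorem apply_of_mul_inv_mem (f : cIndSpace H σ) {g g' : G} (h : g * g'⁻¹ ∈ H) :
    f.1 g = σ ⟨g * g'⁻¹, h⟩ (f.1 g') := by
  rw [← f.2.2.2, inv_mul_cancel_right]

variable (σ) in
/-- The functions in `cInd_H^G σ` supported on a set `T` of cosets. The support of a function is
a union of cosets `H * g`; it is recorded by the cosets `g⁻¹ * H`, on which `G` acts from the
left. -/
def supportedOn (T : Set (G ⧸ H)) : Submodule k (cIndSpace H σ) where
  carrier := {f | ∀ g, f.1 g ≠ 0 → ((g⁻¹ : G) : G ⧸ H) ∈ T}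
  zero_mem' := fun _ hg => absurd rfl hg
  add_mem' := by
    intro f₁ f₂ h₁ h₂ g hg
    by_cases h : f₁.1 g = 0
    · exact h₂ g fun h' => hg (by simp [h, h'])
    · exact h₁ g h
  smul_mem' := fun a f hf g hg => hf g fun h => hg (by simp [h])

theorem supportedOn_mono {T₁ T₂ : Set (G ⧸ H)} (h : T₁ ⊆ T₂) :
    supportedOn σ T₁ ≤ supportedOn σ T₂ :=
  fun _ hf g hg => h (hf g hg)

theorem cInd_mem_supportedOn_smul {T : Set (G ⧸ H)} {f : cIndSpace H σ} (g : G)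
    (hf : f ∈ supportedOn σ T) : cInd H σ g f ∈ supportedOn σ (g • T) := by
  intro x hx
  rw [Set.mem_smul_set_iff_inv_smul_mem, MulAction.Quotient.smul_mk, smul_eq_mul, ← mul_inv_rev]
  exact hf (x * g) hx

theorem map_cInd_supportedOn (g : G) (T : Set (G ⧸ H)) :
    (supportedOn σ T).map (cInd H σ g) = supportedOn σ (g • T) := by
  apply le_antisymm
  · rintro _ ⟨f, hf, rfl⟩
    exact cInd_mem_supportedOn_smul g hf
  · intro f hf
    refine ⟨cInd H σ g⁻¹ f, ?_, Representation.self_inv_apply _ _ _⟩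
    have := cInd_mem_supportedOn_smul g⁻¹ hf
    rwa [inv_smul_smul] at this

variable (hH : IsOpen (H : Set G))

/-- The restriction of a function in `cInd_H^G σ` to a set of cosets, extended by zero. -/
def restrict (T : Set (G ⧸ H)) : cIndSpace H σ →ₗ[k] cIndSpace H σ where
  toFun f := ⟨Set.indicator {g | ((g⁻¹ : G) : G ⧸ H) ∈ T} f.1, by
    classical
    obtain ⟨f, hf, ⟨C, hC, hfC⟩, hσ⟩ := f
    refine ⟨((isLocallyConstant_mk_inv hH).prodMk hf).comp fun p => if p.1 ∈ T then p.2 else 0,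
      ⟨C, hC, fun g hg => hfC g fun h => hg (by simp [Set.indicator, h])⟩, fun h g => ?_⟩
    have hmk : (((h * g : G)⁻¹ : G) : G ⧸ H) = (g⁻¹ : G) :=
      mk_inv_eq_mk_inv_iff.2 (by simp)
    simp only [Set.indicator, Set.mem_ofPred_eq, hmk, hσ, apply_ite (σ h), map_zero]⟩
  map_add' f₁ f₂ := by
    ext g
    exact congrFun (Set.indicator_add _ f₁.1 f₂.1) g
  map_smul' a f := by
    ext g
    exact congrFun (Set.indicator_const_smul _ a f.1) g

theorem coe_restrict (T : Set (G ⧸ H)) (f : cIndSpace H σ) :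
    (restrict hH T f : G → V) = Set.indicator {g | ((g⁻¹ : G) : G ⧸ H) ∈ T} f :=
  rfl

theorem restrict_mem_inter {T T' : Set (G ⧸ H)} {f : cIndSpace H σ} (hf : f ∈ supportedOn σ T') :
    restrict hH T f ∈ supportedOn σ (T ∩ T') := by
  intro g hg
  rw [coe_restrict, Set.indicator_apply_ne_zero] at hg
  exact ⟨hg.1, hf g hg.2⟩

theorem restrict_mem (T : Set (G ⧸ H)) (f : cIndSpace H σ) :
    restrict hH T f ∈ supportedOn σ T := by
  intro g hg
  rw [coe_restrict, Set.indicator_apply_ne_zero] at hg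
  exact hg.1

theorem restrict_eq_self {T : Set (G ⧸ H)} {f : cIndSpace H σ} (hf : f ∈ supportedOn σ T) :
    restrict hH T f = f := by
  apply Subtype.ext
  rw [coe_restrict]
  exact Set.indicator_eq_self.2 hf

theorem sum_restrict {ι : Type*} (s : Finset ι) {B : ι → Set (G ⧸ H)}
    (hB : (s : Set ι).PairwiseDisjoint B) (f : cIndSpace H σ) :
    ∑ i ∈ s, restrict hH (B i) f = restrict hH (⋃ i ∈ s, B i) f := by
  let mkInv : G → G ⧸ H := fun g => ((g⁻¹ : G) : G ⧸ H)
  have hunion : mkInv ⁻¹' (⋃ i ∈ s, B i) = ⋃ i ∈ s, mkInv ⁻¹' B i := Set.preimage_iUnion₂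
  have hdisj : (s : Set ι).PairwiseDisjoint fun i => mkInv ⁻¹' B i :=
    fun i hi j hj hij => (hB hi hj hij).preimage mkInv
  ext g
  rw [coe_restrict]
  change _ = Set.indicator (mkInv ⁻¹' (⋃ i ∈ s, B i)) f.1 g
  rw [hunion, Finset.indicator_biUnion_apply s _ hdisj, Submodule.coe_sum, Finset.sum_apply]
  rfl

theorem restrict_add_restrict_compl (T : Set (G ⧸ H)) (f : cIndSpace H σ) :
    restrict hH T f + restrict hH Tᶜ f = f :=
  Subtype.ext (Set.indicator_self_add_compl {g : G | ((g⁻¹ : G) : G ⧸ H) ∈ T} f.1)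

theorem restrict_eq_zero {T : Set (G ⧸ H)} {f : cIndSpace H σ} (hf : f ∈ supportedOn σ Tᶜ) :
    restrict hH T f = 0 := by
  simpa only [restrict_eq_self hH hf, add_eq_right] using restrict_add_restrict_compl hH T f

theorem cInd_restrict (g : G) (T : Set (G ⧸ H)) (f : cIndSpace H σ) :
    cInd H σ g (restrict hH T f) = restrict hH (g • T) (cInd H σ g f) := by
  rw [← restrict_eq_self hH (cInd_mem_supportedOn_smul g (restrict_mem hH T f)), eq_comm]
  conv_lhs => rw [← restrict_add_restrict_compl hH T f, map_add, map_add]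
  rw [add_eq_left]
  apply restrict_eq_zero
  rw [← Set.smul_set_compl]
  exact cInd_mem_supportedOn_smul g (restrict_mem hH Tᶜ f)

include hH in
theorem exists_finset_mem_supportedOn (f : cIndSpace H σ) :
    ∃ T : Finset (G ⧸ H), f ∈ supportedOn σ (T : Set (G ⧸ H)) := by
  obtain ⟨C, hC, hfC⟩ := f.2.2.1
  refine ⟨(finite_image_of_isLocallyConstant (isLocallyConstant_mk_inv hH) hC).toFinset,
    fun g hg => ?_⟩
  obtain ⟨h, hh, c, hc, rfl⟩ := hfC g hg
  rw [Set.Finite.coe_toFinset]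
  exact ⟨c, hc, mk_inv_eq_mk_inv_iff.2 (by simpa using hh)⟩

theorem finiteDimensional_supportedOn [FiniteDimensional k V] {T : Set (G ⧸ H)} (hT : T.Finite) :
    FiniteDimensional k (supportedOn σ T) := by
  have := hT.to_subtype
  let ev : supportedOn σ T →ₗ[k] (T → V) := LinearMap.pi fun x =>
    LinearMap.proj (x.1.out⁻¹) ∘ₗ (cIndSpace H σ).subtype ∘ₗ (supportedOn σ T).subtype
  refine Module.Finite.of_injective ev fun f₁ f₂ hf => ?_
  ext g
  by_cases hg : ((g⁻¹ : G) : G ⧸ H) ∈ T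
  · have hout : f₁.1.1 (Quotient.out ((g⁻¹ : G) : G ⧸ H))⁻¹ =
        f₂.1.1 (Quotient.out ((g⁻¹ : G) : G ⧸ H))⁻¹ := congrFun hf ⟨_, hg⟩
    have hmem : g * ((Quotient.out ((g⁻¹ : G) : G ⧸ H))⁻¹)⁻¹ ∈ H :=
      mk_inv_eq_mk_inv_iff.1 (by simp)
    rw [apply_of_mul_inv_mem f₁.1 hmem, apply_of_mul_inv_mem f₂.1 hmem, hout]
  · rw [not_imp_comm.1 (f₁.2 g) hg, not_imp_comm.1 (f₂.2 g) hg]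

theorem bracket_mem_supportedOn {f : cIndSpace H σ} {g : G} {v : V}
    (hf : (f : G → V) = bracket H σ g v) : f ∈ supportedOn σ {(g : G ⧸ H)} := by
  intro x hx
  rw [hf] at hx
  have : x * g ∈ H := by
    by_contra h
    simp [bracket, h] at hx
  rw [Set.mem_singleton_iff, QuotientGroup.eq, inv_inv]
  exact this

theorem coe_restrict_singleton_mk (f : cIndSpace H σ) (g : G) :
    (restrict hH {(g : G ⧸ H)} f : G → V) = bracket H σ g (f.1 g⁻¹) := by
  ext x
  rw [coe_restrict, bracket]
  have hmem : ((x⁻¹ : G) : G ⧸ H) ∈ ({(g : G ⧸ H)} : Set (G ⧸ H)) ↔ x * g ∈ H := by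
    rw [Set.mem_singleton_iff, QuotientGroup.eq, inv_inv]
  by_cases h : x * g ∈ H
  · rw [Set.indicator_of_mem (by exact hmem.2 h), dif_pos h,
      apply_of_mul_inv_mem f (g' := g⁻¹) (by rwa [inv_inv])]
    simp only [inv_inv]
  · rw [Set.indicator_of_notMem (by exact fun h' => h (hmem.1 h')), dif_neg h]

include hH in
theorem span_bracket_eq_supportedOn (T : Set G) :
    Submodule.span k {f : cIndSpace H σ | ∃ g ∈ T, ∃ v : V, (f : G → V) = bracket H σ g v} =
      supportedOn σ ((fun g : G => (g : G ⧸ H)) '' T) := by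
  apply le_antisymm
  · refine Submodule.span_le.2 ?_
    rintro f ⟨g, hg, v, hf⟩
    exact supportedOn_mono (Set.singleton_subset_iff.2 (Set.mem_image_of_mem _ hg))
      (bracket_mem_supportedOn hf)
  · intro f hf
    obtain ⟨s, hs⟩ := exists_finset_mem_supportedOn hH f
    have hsum : ∑ x ∈ s, restrict hH {x} f = f := by
      rw [sum_restrict hH s fun x _ y _ hxy => Set.disjoint_singleton.2 hxy]
      exact restrict_eq_self hH (by rwa [← Set.biUnion_of_singleton (s : Set (G ⧸ H))] at hs)
    rw [← hsum]
    refine Submodule.sum_mem _ fun x _ => ?_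
    by_cases hx : x ∈ (fun g : G => (g : G ⧸ H)) '' T
    · obtain ⟨g, hg, rfl⟩ := hx
      exact Submodule.subset_span ⟨g, hg, _, coe_restrict_singleton_mk hH f g⟩
    · rw [restrict_eq_zero hH (supportedOn_mono (Set.subset_compl_singleton_iff.2 hx) hf)]
      exact Submodule.zero_mem _

end Supports

section HalfTrees

variable {G ι : Type*} [Group G]

/-- An exhaustion of the vertices `G ⧸ H` that behaves like the balls `S n` of radius `n` around
the base vertex for a `G`-invariant metric. -/
structure IsBallFiltration (H : Subgroup G) (S : ℕ → Set (G ⧸ H)) : Prop where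
  zero : S 0 = {((1 : G) : G ⧸ H)}
  mono : Monotone S
  smul_mem : ∀ {m n : ℕ} {g : G} {x : G ⧸ H}, (g : G ⧸ H) ∈ S m → x ∈ S n → g • x ∈ S (m + n)
  exists_mem : ∀ x : G ⧸ H, ∃ n, x ∈ S n

/-- The properties used here of a half-tree `P` among the vertices `G ⧸ H` of a regular tree with
balls `S n`. An edge joins the base vertex, which lies in `P`, to its image under `w`, which does
not. The element `w` flips this edge and exchanges the two half-trees that remain when the edge is
removed, and the `h i` move `Pᶜ` to the branches `h i • Pᶜ` of `P` at the base vertex. -/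
structure IsHalfTree {H : Subgroup G} (S : ℕ → Set (G ⧸ H)) (P : Set (G ⧸ H)) (w : G)
    (h : ι → G) : Prop extends IsBallFiltration H S where
  one_mem : ((1 : G) : G ⧸ H) ∈ P
  flip_smul : w • P = Pᶜ
  flip_mul_flip_mem : w * w ∈ H
  flip_mem_ball : (w : G ⧸ H) ∈ S 1
  flip_inv_smul_mem_of_mem_succ : ∀ {n : ℕ} {x : G ⧸ H}, x ∉ P → x ∈ S (n + 1) → w⁻¹ • x ∈ S n
  mem : ∀ i, h i ∈ H
  subset_branches : P ⊆ insert ((1 : G) : G ⧸ H) (⋃ i, h i • Pᶜ)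
  disjoint_branches : Pairwise (Function.onFun Disjoint fun i => h i • Pᶜ)
  smul_ball_subset : ∀ {m : ℕ} {g : G}, (g : G ⧸ H) ∈ P → (g : G ⧸ H) ∉ S m → g • S m ⊆ P

variable {H : Subgroup G} {S : ℕ → Set (G ⧸ H)} {P : Set (G ⧸ H)} {w : G} {h : ι → G}

theorem IsBallFiltration.smul_mem_of_mem (hS : IsBallFiltration H S) {n : ℕ} {g : G} {x : G ⧸ H}
    (hg : g ∈ H) (hx : x ∈ S n) : g • x ∈ S n := by
  have hg0 : (g : G ⧸ H) ∈ S 0 := by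
    rw [hS.zero, Set.mem_singleton_iff, QuotientGroup.eq, mul_one]
    exact H.inv_mem hg
  simpa only [zero_add] using hS.smul_mem hg0 hx

theorem IsBallFiltration.one_mem_ball (hS : IsBallFiltration H S) (n : ℕ) :
    ((1 : G) : G ⧸ H) ∈ S n :=
  hS.mono n.zero_le (hS.zero ▸ Set.mem_singleton _)

namespace IsHalfTree

theorem inv_smul_mem_iff (hP : IsHalfTree S P w h) (x : G ⧸ H) : w⁻¹ • x ∈ P ↔ x ∉ P := by
  rw [← Set.mem_smul_set_iff_inv_smul_mem, hP.flip_smul, Set.mem_compl_iff]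

theorem smul_eq_branch (hP : IsHalfTree S P w h) (i : ι) : (h i * w) • P = h i • Pᶜ := by
  rw [mul_smul, hP.flip_smul]

theorem eq_one_of_notMem_branches (hP : IsHalfTree S P w h) {x : G ⧸ H} (hx : x ∈ P)
    (hxb : x ∉ ⋃ i, (h i * w) • P) : x = ((1 : G) : G ⧸ H) := by
  simp only [hP.smul_eq_branch] at hxb
  exact (hP.subset_branches hx).resolve_right hxb

theorem branch_inv_smul_mem_of_mem_succ (hP : IsHalfTree S P w h) {i : ι} {n : ℕ} {x : G ⧸ H}
    (hx : x ∈ (h i * w) • P) (hxn : x ∈ S (n + 1)) : (h i * w)⁻¹ • x ∈ S n := by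
  rw [hP.smul_eq_branch, Set.mem_smul_set_iff_inv_smul_mem] at hx
  rw [mul_inv_rev, mul_smul]
  exact hP.flip_inv_smul_mem_of_mem_succ hx (hP.smul_mem_of_mem (H.inv_mem (hP.mem i)) hxn)

theorem flip_inv_smul_mem_ball (hP : IsHalfTree S P w h) {n : ℕ} {x : G ⧸ H}
    (hxP : x ∉ P) (hx : x ∈ S n) : w⁻¹ • x ∈ S n :=
  hP.flip_inv_smul_mem_of_mem_succ hxP (hP.mono n.le_succ hx)

theorem flip_smul_mem_ball (hP : IsHalfTree S P w h) {n : ℕ} {x : G ⧸ H}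
    (hxP : x ∉ P) (hx : x ∈ S n) : w • x ∈ S n := by
  have hw : w • x = (w * w) • w⁻¹ • x := by rw [smul_smul, mul_inv_cancel_right]
  rw [hw]
  exact hP.smul_mem_of_mem hP.flip_mul_flip_mem (hP.flip_inv_smul_mem_ball hxP hx)

theorem finite_ball [Finite ι] (hP : IsHalfTree S P w h) (n : ℕ) : (S n).Finite := by
  induction n with
  | zero => exact hP.zero ▸ Set.finite_singleton _
  | succ n ih =>
    refine (((Set.finite_iUnion fun i => ih.image ((h i * w) • ·)).insert
      ((1 : G) : G ⧸ H)).union (ih.image (w • ·))).subset fun x hx => ?_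
    by_cases hxP : x ∈ P
    · refine Or.inl ((hP.subset_branches hxP).imp id fun hxb => ?_)
      obtain ⟨i, hi⟩ := Set.mem_iUnion.1 hxb
      rw [← hP.smul_eq_branch] at hi
      exact Set.mem_iUnion.2
        ⟨i, _, hP.branch_inv_smul_mem_of_mem_succ hi hx, smul_inv_smul _ _⟩
    · exact Or.inr ⟨_, hP.flip_inv_smul_mem_of_mem_succ hxP hx, smul_inv_smul _ _⟩

theorem branch_smul_mem_ball (hP : IsHalfTree S P w h) (i : ι) {n : ℕ} {x : G ⧸ H}
    (hxP : x ∉ P) (hx : x ∈ S n) : (h i * w) • x ∈ S n := by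
  rw [mul_smul]
  exact hP.smul_mem_of_mem (hP.mem i) (hP.flip_smul_mem_ball hxP hx)

theorem branch_inv_smul_mem_ball (hP : IsHalfTree S P w h) {i : ι} {n : ℕ} {x : G ⧸ H}
    (hx : x ∈ (h i * w) • P) (hxn : x ∈ S n) : (h i * w)⁻¹ • x ∈ S n :=
  hP.branch_inv_smul_mem_of_mem_succ hx (hP.mono n.le_succ hxn)

theorem smul_ball_subset_or (hP : IsHalfTree S P w h) {m : ℕ} {g : G}
    (hg : (g : G ⧸ H) ∉ S (m + 1)) : g • S m ⊆ P ∨ g • S m ⊆ Pᶜ := by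
  by_cases hgP : (g : G ⧸ H) ∈ P
  · exact Or.inl (hP.smul_ball_subset hgP fun hgm => hg (hP.mono m.le_succ hgm))
  · right
    have hwP : ((w⁻¹ * g : G) : G ⧸ H) ∈ P := (hP.inv_smul_mem_iff g).2 hgP
    have hwS : ((w⁻¹ * g : G) : G ⧸ H) ∉ S m := fun hm => hg (by
      have := hP.smul_mem hP.flip_mem_ball hm
      rwa [MulAction.Quotient.smul_mk, smul_eq_mul, mul_inv_cancel_left, add_comm] at this)
    have := Set.smul_set_mono (a := w) (hP.smul_ball_subset hwP hwS)
    rwa [smul_smul, mul_inv_cancel_left, hP.flip_smul] at this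

end IsHalfTree

end HalfTrees

section Subrepresentations

variable {k G V : Type*} [Field k] [Group G] [AddCommGroup V] [Module k V]
  {ρ : Representation k G V}

theorem asSubmodule_fg_iff (U : Subrepresentation ρ) :
    U.asSubmodule.FG ↔ ∃ s : Finset V, (s : Set V) ⊆ U ∧
      ∀ M : Subrepresentation ρ, (s : Set V) ⊆ M → U ≤ M := by
  constructor
  · rintro ⟨s, hs⟩
    refine ⟨s, fun v hv => ?_, fun M hM v hv => ?_⟩
    · have : v ∈ U.asSubmodule := hs ▸ Submodule.subset_span hv
      exact this
    · have hv : v ∈ U.asSubmodule := hv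
      rw [← hs] at hv
      exact (Submodule.span_le (p := M.asSubmodule)).2 hM hv
  · rintro ⟨s, hsU, hs⟩
    refine ⟨s, le_antisymm (Submodule.span_le.2 hsU) ?_⟩
    let M : Submodule k[G] ρ.asModule := Submodule.span (M := ρ.asModule) k[G] (s : Set V)
    exact hs (Subrepresentation.ofSubmodule' M)
      (Submodule.subset_span (R := k[G]) (M := ρ.asModule))

theorem exists_subrepresentation_between {s : Set V} {A : Submodule k V}
    (hs : ∀ g, ∀ v ∈ s, ρ g v ∈ A) :
    ∃ M : Subrepresentation ρ, s ⊆ M ∧ M.toSubmodule ≤ A := by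
  refine ⟨⟨⨅ g, A.comap (ρ g), fun g v hv => ?_⟩, fun v hv => ?_, fun v hv => ?_⟩
  · simp only [Submodule.mem_iInf, Submodule.mem_comap] at hv ⊢
    intro g'
    rw [← Module.End.mul_apply, ← map_mul]
    exact hv (g' * g)
  · exact (Submodule.mem_iInf _).2 fun g => hs g v hv
  · simpa using (Submodule.mem_iInf _).1 hv 1

end Subrepresentations

section EdgeSpace

variable {k G V W ι : Type*} [Field k] [Group G] [TopologicalSpace G] [ContinuousMul G]
  [AddCommGroup V] [Module k V] [AddCommGroup W] [Module k W] {H : Subgroup G}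
  {σ : Representation k H V} {π : Representation k G W}
  (φ : Representation.IntertwiningMap (cInd H σ) π) {S : ℕ → Set (G ⧸ H)} {P : Set (G ⧸ H)}

/-- The intersection of the images in `π` of the functions supported on the two parts `P` and `Pᶜ`
of `G ⧸ H`. -/
def edgeSpace (P : Set (G ⧸ H)) : Submodule k W :=
  (supportedOn σ P).map φ.toLinearMap ⊓ (supportedOn σ Pᶜ).map φ.toLinearMap

theorem apply_restrict_mem_edgeSpace (hH : IsOpen (H : Set G)) {f : cIndSpace H σ}
    (hf : φ f = 0) : φ (restrict hH P f) ∈ edgeSpace φ P := by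
  refine ⟨⟨_, restrict_mem hH P f, rfl⟩, -restrict hH Pᶜ f,
    neg_mem (restrict_mem hH Pᶜ f), ?_⟩
  have hsum : φ (restrict hH P f) + φ (restrict hH Pᶜ f) = 0 := by
    rw [← map_add, restrict_add_restrict_compl, hf]
  rw [map_neg]
  exact (eq_neg_of_add_eq_zero_left hsum).symm

theorem edgeSpace_eq_map_ker (hH : IsOpen (H : Set G)) :
    edgeSpace φ P = φ.ker.toSubmodule.map (φ.toLinearMap ∘ₗ restrict hH P) := by
  apply le_antisymm
  · rintro _ ⟨⟨f₁, hf₁, rfl⟩, f₂, hf₂, hf⟩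
    refine ⟨f₁ - f₂, LinearMap.sub_mem_ker_iff.2 hf.symm, ?_⟩
    rw [LinearMap.comp_apply, map_sub, restrict_eq_self hH hf₁, restrict_eq_zero hH hf₂,
      sub_zero]
  · rintro _ ⟨f, hf, rfl⟩
    exact apply_restrict_mem_edgeSpace φ hH hf

theorem IsBallFiltration.exists_mem_supportedOn_inter (hS : IsBallFiltration H S)
    (hH : IsOpen (H : Set G)) {T : Set (G ⧸ H)} {f : cIndSpace H σ} (hf : f ∈ supportedOn σ T) :
    ∃ n, f ∈ supportedOn σ (S n ∩ T) := by
  obtain ⟨s, hs⟩ := exists_finset_mem_supportedOn hH f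
  choose N hN using hS.exists_mem
  refine ⟨s.sup N, fun g hg => ⟨?_, hf g hg⟩⟩
  exact hS.mono (Finset.le_sup (hs g hg)) (hN _)

theorem IsBallFiltration.exists_le_map_supportedOn_inter (hS : IsBallFiltration H S)
    (hH : IsOpen (H : Set G)) {T : Set (G ⧸ H)} {E : Submodule k W} [FiniteDimensional k E]
    (hE : E ≤ (supportedOn σ T).map φ.toLinearMap) :
    ∃ n, E ≤ (supportedOn σ (S n ∩ T)).map φ.toLinearMap := by
  have hmono : Monotone fun n => (supportedOn σ (S n ∩ T)).map φ.toLinearMap := fun m n hmn =>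
    Submodule.map_mono (supportedOn_mono (Set.inter_subset_inter_left T (hS.mono hmn)))
  have hsup : supportedOn σ T ≤ ⨆ n, supportedOn σ (S n ∩ T) := fun f hf =>
    have ⟨n, hn⟩ := hS.exists_mem_supportedOn_inter hH hf
    Submodule.mem_iSup_of_mem n hn
  have hcompact := (Submodule.fg_iff_compact E).1
    ((Submodule.fg_iff_finiteDimensional E).2 ‹_›)
  obtain ⟨_, ⟨n, rfl⟩, hn⟩ :=
    (CompleteLattice.isCompactElement_iff_le_of_directed_sSup_le _ E).1 hcompact
      (Set.range fun n => (supportedOn σ (S n ∩ T)).map φ.toLinearMap) (Set.range_nonempty _)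
      hmono.directed_le.directedOn_range
      ((hE.trans (Submodule.map_mono hsup)).trans_eq (Submodule.map_iSup _ _))
  exact ⟨n, hn⟩

namespace IsHalfTree

variable {φ} {w : G} {h : ι → G}

theorem exists_ker_le (hP : IsHalfTree S P w h) (hH : IsOpen (H : Set G))
    (hφ : φ.ker.asSubmodule.FG) :
    ∃ N, φ.ker.toSubmodule ≤ φ.ker.toSubmodule ⊓ supportedOn σ P ⊔
      φ.ker.toSubmodule ⊓ supportedOn σ Pᶜ ⊔ supportedOn σ (S N) := by
  obtain ⟨s, hs, hgen⟩ := (asSubmodule_fg_iff _).1 hφ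
  choose m hm using fun f : cIndSpace H σ =>
    hP.exists_mem_supportedOn_inter hH (f := f) (T := Set.univ) fun _ _ => Set.mem_univ _
  set N := s.sup m
  have hsN : ∀ f ∈ s, f ∈ supportedOn σ (S N) := fun f hf =>
    supportedOn_mono (Set.inter_subset_left.trans (hP.mono (Finset.le_sup hf))) (hm f)
  obtain ⟨M, hsM, hM⟩ := exists_subrepresentation_between (ρ := cInd H σ) (s := (s : Set _))
    (A := φ.ker.toSubmodule ⊓ supportedOn σ P ⊔ φ.ker.toSubmodule ⊓ supportedOn σ Pᶜ ⊔
      supportedOn σ (S (N + 1 + N))) fun g f hf => by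
    have hker : cInd H σ g f ∈ φ.ker.toSubmodule := φ.ker.apply_mem_toSubmodule g (hs hf)
    have hsupp := cInd_mem_supportedOn_smul g (hsN f hf)
    by_cases hg : (g : G ⧸ H) ∈ S (N + 1)
    · refine Submodule.mem_sup_right (supportedOn_mono ?_ hsupp)
      rintro _ ⟨x, hx, rfl⟩
      exact hP.smul_mem hg hx
    · refine Submodule.mem_sup_left ?_
      rcases hP.smul_ball_subset_or hg with hgP | hgP
      · exact Submodule.mem_sup_left ⟨hker, supportedOn_mono hgP hsupp⟩
      · exact Submodule.mem_sup_right ⟨hker, supportedOn_mono hgP hsupp⟩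
  exact ⟨_, fun f hf => hM (hgen M hsM hf)⟩

theorem finiteDimensional_edgeSpace [Finite ι] [FiniteDimensional k V]
    (hP : IsHalfTree S P w h) (hH : IsOpen (H : Set G)) (hφ : φ.ker.asSubmodule.FG) :
    FiniteDimensional k (edgeSpace φ P) := by
  obtain ⟨N, hN⟩ := hP.exists_ker_le hH hφ
  have := finiteDimensional_supportedOn (σ := σ) (hP.finite_ball N)
  suffices hle : edgeSpace φ P ≤
      (supportedOn σ (S N)).map (φ.toLinearMap ∘ₗ restrict hH P) from
    Submodule.finiteDimensional_of_le hle
  rw [edgeSpace_eq_map_ker φ hH]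
  refine (Submodule.map_mono hN).trans ?_
  have hcomp : (φ.ker.toSubmodule ⊓ supportedOn σ P).map (φ.toLinearMap ∘ₗ restrict hH P) = ⊥ := by
    rw [eq_bot_iff]
    rintro _ ⟨f, ⟨hf, hfP⟩, rfl⟩
    rw [LinearMap.comp_apply, restrict_eq_self hH hfP]
    exact hf
  have hcompl : (φ.ker.toSubmodule ⊓ supportedOn σ Pᶜ).map
      (φ.toLinearMap ∘ₗ restrict hH P) = ⊥ := by
    rw [eq_bot_iff]
    rintro _ ⟨f, ⟨-, hfP⟩, rfl⟩
    rw [LinearMap.comp_apply, restrict_eq_zero hH hfP, map_zero]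
    exact Submodule.zero_mem _
  rw [Submodule.map_sup, Submodule.map_sup, hcomp, hcompl, bot_sup_eq, bot_sup_eq]

theorem exists_apply_eq_apply_restrict (hH : IsOpen (H : Set G)) {T : Set (G ⧸ H)}
    (hT : edgeSpace φ P ≤ (supportedOn σ T).map φ.toLinearMap) {f : cIndSpace H σ}
    (hf : φ f = 0) (g : G) :
    ∃ e ∈ supportedOn σ (g • T), φ e = φ (restrict hH (g • P) f) := by
  have hf' : φ (cInd H σ g⁻¹ f) = 0 := by rw [φ.isIntertwining, hf, map_zero]
  obtain ⟨e, he, heq⟩ := hT (apply_restrict_mem_edgeSpace φ hH hf')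
  refine ⟨cInd H σ g e, cInd_mem_supportedOn_smul g he, ?_⟩
  have heq : φ e = φ (restrict hH P (cInd H σ g⁻¹ f)) := heq
  rw [φ.isIntertwining, heq, ← φ.isIntertwining, cInd_restrict, Representation.self_inv_apply]

variable {N : ℕ} {M : Subrepresentation (cInd H σ)}

theorem restrict_branch_sub_mem (hP : IsHalfTree S P w h) (hH : IsOpen (H : Set G)) {n : ℕ}
    (hM : φ.ker.toSubmodule ⊓ supportedOn σ (S n ∩ P ∪ S N) ≤ M.toSubmodule)
    {f : cIndSpace H σ} (hf : f ∈ supportedOn σ (S (n + 1) ∩ P ∪ S N)) {i : ι}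
    {e : cIndSpace H σ} (he : e ∈ supportedOn σ ((h i * w) • (S N ∩ Pᶜ)))
    (hφe : φ e = φ (restrict hH ((h i * w) • P) f)) :
    restrict hH ((h i * w) • P) f - e ∈ M := by
  set c := h i * w
  have hr := cInd_mem_supportedOn_smul c⁻¹ (restrict_mem_inter hH (T := c • P) hf)
  have he := cInd_mem_supportedOn_smul c⁻¹ he
  have hmem : cInd H σ c⁻¹ (restrict hH (c • P) f - e) ∈ M.toSubmodule := by
    refine hM ⟨φ.ker.apply_mem_toSubmodule _ ?_, ?_⟩
    · exact LinearMap.sub_mem_ker_iff.2 hφe.symm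
    · rw [map_sub]
      refine sub_mem (supportedOn_mono ?_ hr) (supportedOn_mono ?_ he)
      · rintro _ ⟨x, ⟨hxc, hx⟩, rfl⟩
        exact hx.imp
          (fun hx => ⟨hP.branch_inv_smul_mem_of_mem_succ hxc hx.1,
            Set.mem_smul_set_iff_inv_smul_mem.1 hxc⟩)
          (hP.branch_inv_smul_mem_ball hxc)
      · rw [inv_smul_smul]
        exact Set.inter_subset_left.trans Set.subset_union_right
  have := M.apply_mem_toSubmodule c hmem
  rwa [Representation.self_inv_apply] at this

theorem sum_restrict_branches [Fintype ι] (hP : IsHalfTree S P w h) (hH : IsOpen (H : Set G))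
    (f : cIndSpace H σ) :
    ∑ i, restrict hH ((h i * w) • P) f = restrict hH (⋃ i, (h i * w) • P) f := by
  have hdisj : ((Finset.univ : Finset ι) : Set ι).PairwiseDisjoint fun i => (h i * w) • P := by
    simp only [hP.smul_eq_branch]
    exact hP.disjoint_branches.set_pairwise _
  simp only [sum_restrict hH _ hdisj, Finset.mem_univ, Set.iUnion_true]

theorem ker_inf_supportedOn_le [Finite ι] (hP : IsHalfTree S P w h) (hH : IsOpen (H : Set G))
    (hN : edgeSpace φ P ≤ (supportedOn σ (S N ∩ Pᶜ)).map φ.toLinearMap)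
    (hM : φ.ker.toSubmodule ⊓ supportedOn σ (S N) ≤ M.toSubmodule) (n : ℕ) :
    φ.ker.toSubmodule ⊓ supportedOn σ (S n ∩ P ∪ S N) ≤ M.toSubmodule := by
  induction n with
  | zero =>
    refine (inf_le_inf_left _ (supportedOn_mono ?_)).trans hM
    exact Set.union_subset (Set.inter_subset_left.trans (hP.mono N.zero_le)) subset_rfl
  | succ n ih =>
    rintro f ⟨hf, hfS⟩
    have := Fintype.ofFinite ι
    choose e he hφe using fun i => exists_apply_eq_apply_restrict hH hN hf (h i * w)
    let r := fun i => restrict hH ((h i * w) • P) f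
    have hre : ∀ i, r i - e i ∈ M.toSubmodule := fun i =>
      hP.restrict_branch_sub_mem hH ih hfS (he i) (hφe i)
    have hreker : ∀ i, r i - e i ∈ φ.ker.toSubmodule := fun i =>
      LinearMap.sub_mem_ker_iff.2 (hφe i).symm
    have hrest : f - ∑ i, (r i - e i) ∈ supportedOn σ (S N) := by
      have hr : f - ∑ i, r i = restrict hH (⋃ i, (h i * w) • P)ᶜ f := by
        rw [hP.sum_restrict_branches hH, sub_eq_iff_eq_add', restrict_add_restrict_compl]
      rw [Finset.sum_sub_distrib, ← sub_add, hr]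
      refine add_mem (supportedOn_mono ?_ (restrict_mem_inter hH hfS))
        (sum_mem fun i _ => supportedOn_mono ?_ (he i))
      · rintro x ⟨hx, ⟨-, hxP⟩ | hxN⟩
        · rw [hP.eq_one_of_notMem_branches hxP hx]
          exact hP.one_mem_ball N
        · exact hxN
      · rintro _ ⟨x, ⟨hx, hxP⟩, rfl⟩
        exact hP.branch_smul_mem_ball i hxP hx
    rw [← sub_add_cancel f (∑ i, (r i - e i))]
    exact add_mem (hM ⟨sub_mem hf (sum_mem fun i _ => hreker i), hrest⟩)
      (sum_mem fun i _ => hre i)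

theorem mem_of_mem_supportedOn_compl (hP : IsHalfTree S P w h) {n : ℕ}
    (hM : φ.ker.toSubmodule ⊓ supportedOn σ (S n ∩ P ∪ S N) ≤ M.toSubmodule)
    {f : cIndSpace H σ} (hf : f ∈ φ.ker.toSubmodule)
    (hfS : f ∈ supportedOn σ (Pᶜ ∩ (S n ∪ S N))) : f ∈ M.toSubmodule := by
  have hmem : cInd H σ w⁻¹ f ∈ M.toSubmodule := by
    refine hM ⟨φ.ker.apply_mem_toSubmodule _ hf,
      supportedOn_mono ?_ (cInd_mem_supportedOn_smul w⁻¹ hfS)⟩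
    rintro _ ⟨x, ⟨hxP, hx⟩, rfl⟩
    exact hx.imp
      (fun hx => ⟨hP.flip_inv_smul_mem_ball hxP hx, (hP.inv_smul_mem_iff x).2 hxP⟩)
      (hP.flip_inv_smul_mem_ball hxP)
  have := M.apply_mem_toSubmodule w hmem
  rwa [Representation.self_inv_apply] at this

theorem ker_le [Finite ι] (hP : IsHalfTree S P w h) (hH : IsOpen (H : Set G))
    (hN : edgeSpace φ P ≤ (supportedOn σ (S N ∩ Pᶜ)).map φ.toLinearMap)
    (hM : φ.ker.toSubmodule ⊓ supportedOn σ (S N) ≤ M.toSubmodule) : φ.ker ≤ M := by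
  intro f hf
  obtain ⟨n, hn⟩ := hP.exists_mem_supportedOn_inter hH (f := f) (T := Set.univ)
    fun _ _ => Set.mem_univ _
  obtain ⟨e, he, hφe⟩ := hN (apply_restrict_mem_edgeSpace φ hH (P := P) hf)
  replace hφe : φ e = φ (restrict hH P f) := hφe
  replace hn : f ∈ supportedOn σ (S n) := supportedOn_mono Set.inter_subset_left hn
  have hle := hP.ker_inf_supportedOn_le hH hN hM n
  have hker : restrict hH P f - e ∈ φ.ker.toSubmodule :=
    LinearMap.sub_mem_ker_iff.2 hφe.symm
  have hadd : (restrict hH P f - e) + (restrict hH Pᶜ f + e) = f := by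
    rw [sub_add_add_cancel, restrict_add_restrict_compl]
  have hmem : restrict hH P f - e ∈ M.toSubmodule := by
    refine hle ⟨hker, sub_mem (supportedOn_mono ?_ (restrict_mem_inter hH hn))
      (supportedOn_mono ?_ he)⟩
    · exact fun x hx => Or.inl hx.symm
    · exact fun x hx => Or.inr hx.1
  have hcompl : restrict hH Pᶜ f + e ∈ M.toSubmodule := by
    refine hP.mem_of_mem_supportedOn_compl hle ?_
      (add_mem (supportedOn_mono ?_ (restrict_mem_inter hH hn)) (supportedOn_mono ?_ he))
    · exact eq_sub_of_add_eq' hadd ▸ sub_mem hf hker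
    · exact Set.inter_subset_inter_right _ Set.subset_union_left
    · exact fun x hx => ⟨hx.2, Or.inr hx.1⟩
  have := add_mem hmem hcompl
  rwa [hadd] at this

theorem fg_asSubmodule_ker [Finite ι] [FiniteDimensional k V]
    (hP : IsHalfTree S P w h) (hH : IsOpen (H : Set G)) [FiniteDimensional k (edgeSpace φ P)] :
    φ.ker.asSubmodule.FG := by
  obtain ⟨N, hN⟩ := hP.exists_le_map_supportedOn_inter φ hH (E := edgeSpace φ P) inf_le_right
  have := finiteDimensional_supportedOn (σ := σ) (hP.finite_ball N)
  have : FiniteDimensional k ↥(φ.ker.toSubmodule ⊓ supportedOn σ (S N)) :=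
    Submodule.finiteDimensional_of_le inf_le_right
  obtain ⟨s, hs⟩ := (Submodule.fg_iff_finiteDimensional _).2 this
  refine (asSubmodule_fg_iff _).2 ⟨s, ?_, fun M hsM => hP.ker_le hH hN ?_⟩
  · exact fun f hf => (hs.le (Submodule.subset_span hf)).1
  · rw [← hs]
    exact Submodule.span_le.2 hsM

theorem finiteDimensional_edgeSpace_iff [Finite ι] [FiniteDimensional k V]
    (hP : IsHalfTree S P w h) (hH : IsOpen (H : Set G)) :
    FiniteDimensional k (edgeSpace φ P) ↔ φ.ker.asSubmodule.FG :=
  ⟨fun _ => hP.fg_asSubmodule_ker hH, hP.finiteDimensional_edgeSpace hH⟩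

end IsHalfTree

end EdgeSpace

section Norms

open Matrix

section MonoidWithZero

variable {R Γ m n o : Type*} [CommRing R] [LinearOrderedCommMonoidWithZero Γ] [Fintype m]
  [Fintype n] [Fintype o] (v : Valuation R Γ)

/-- The sup norm of a vector with respect to a valuation. -/
def vecVal (r : n → R) : Γ :=
  Finset.univ.sup fun i => v (r i)

/-- The sup norm of the entries of a matrix with respect to a valuation. -/
def matVal (A : Matrix m n R) : Γ :=
  Finset.univ.sup fun i => vecVal v (A i)

theorem val_le_vecVal (r : n → R) (i : n) : v (r i) ≤ vecVal v r :=
  Finset.le_sup (f := fun i => v (r i)) (Finset.mem_univ i)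

theorem vecVal_le_iff {r : n → R} {γ : Γ} : vecVal v r ≤ γ ↔ ∀ i, v (r i) ≤ γ := by
  simp only [vecVal, Finset.sup_le_iff, Finset.mem_univ, true_imp_iff]

theorem exists_vecVal_eq [Nonempty n] (r : n → R) : ∃ i, vecVal v r = v (r i) := by
  obtain ⟨i, -, hi⟩ := Finset.univ.exists_mem_eq_sup Finset.univ_nonempty fun i => v (r i)
  exact ⟨i, hi⟩

theorem vecVal_le_matVal (A : Matrix m n R) (i : m) : vecVal v (A i) ≤ matVal v A :=
  Finset.le_sup (f := fun i => vecVal v (A i)) (Finset.mem_univ i)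

theorem val_le_matVal (A : Matrix m n R) (i : m) (j : n) : v (A i j) ≤ matVal v A :=
  (val_le_vecVal v (A i) j).trans (vecVal_le_matVal v A i)

theorem matVal_le_iff_vecVal_le {A : Matrix m n R} {γ : Γ} :
    matVal v A ≤ γ ↔ ∀ i, vecVal v (A i) ≤ γ := by
  simp only [matVal, Finset.sup_le_iff, Finset.mem_univ, true_imp_iff]

theorem matVal_fin_two (A : Matrix (Fin 2) n R) :
    matVal v A = max (vecVal v (A 0)) (vecVal v (A 1)) := by
  simp [matVal, Fin.univ_succ]

theorem matVal_le_iff {A : Matrix m n R} {γ : Γ} : matVal v A ≤ γ ↔ ∀ i j, v (A i j) ≤ γ := by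
  simp only [matVal_le_iff_vecVal_le, vecVal_le_iff]

theorem exists_matVal_eq [Nonempty m] [Nonempty n] (A : Matrix m n R) :
    ∃ i j, matVal v A = v (A i j) := by
  obtain ⟨i, -, hi⟩ := Finset.univ.exists_mem_eq_sup Finset.univ_nonempty fun i => vecVal v (A i)
  obtain ⟨j, hj⟩ := exists_vecVal_eq v (A i)
  exact ⟨i, j, hi.trans hj⟩

theorem vecVal_smul (a : R) (r : n → R) : vecVal v (a • r) = v a * vecVal v r := by
  have hcomp := Finset.apply_sup_eq_sup_comp_of_linearOrder (s := Finset.univ)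
    (f := fun i => v (r i)) (v a * ·) (fun _ _ h => mul_le_mul' le_rfl h)
    (by rw [bot_eq_zero, mul_zero])
  simp only [vecVal, hcomp, Function.comp_def, Pi.smul_apply, smul_eq_mul, map_mul]

theorem matVal_smul (a : R) (A : Matrix m n R) : matVal v (a • A) = v a * matVal v A := by
  have hcomp := Finset.apply_sup_eq_sup_comp_of_linearOrder (s := Finset.univ)
    (f := fun i => vecVal v (A i)) (v a * ·) (fun _ _ h => mul_le_mul' le_rfl h)
    (by rw [bot_eq_zero, mul_zero])
  simp only [matVal, hcomp, Function.comp_def, ← vecVal_smul]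
  rfl

theorem vecVal_add_le (r s : n → R) : vecVal v (r + s) ≤ max (vecVal v r) (vecVal v s) :=
  (vecVal_le_iff v).2 fun i =>
    (v.map_add _ _).trans (max_le_max (val_le_vecVal v r i) (val_le_vecVal v s i))

theorem vecVal_vecMul_le (r : m → R) (A : Matrix m n R) :
    vecVal v (r ᵥ* A) ≤ vecVal v r * matVal v A :=
  (vecVal_le_iff v).2 fun j => v.map_sum_le fun i _ => by
    rw [map_mul]
    exact mul_le_mul' (val_le_vecVal v r i) (val_le_matVal v A i j)

theorem matVal_mul_le (A : Matrix m n R) (B : Matrix n o R) :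
    matVal v (A * B) ≤ matVal v A * matVal v B := by
  refine (matVal_le_iff_vecVal_le v).2 fun i => ?_
  rw [mul_apply_eq_vecMul]
  exact (vecVal_vecMul_le v _ _).trans (mul_le_mul' (vecVal_le_matVal v A i) le_rfl)

theorem mul_row_fin_two (A B : Matrix (Fin 2) (Fin 2) R) (i : Fin 2) :
    (A * B) i = A i 0 • B 0 + A i 1 • B 1 := by
  ext j
  simp [mul_apply, Fin.sum_univ_two]

theorem val_det_le [DecidableEq n] (A : Matrix n n R) :
    v A.det ≤ matVal v A ^ Fintype.card n := by
  rw [det_apply]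
  refine v.map_sum_le fun s _ => ?_
  have hsign : v (Equiv.Perm.sign s • ∏ i, A (s i) i) = v (∏ i, A (s i) i) := by
    rcases Int.units_eq_one_or (Equiv.Perm.sign s) with h | h <;> simp [h]
  rw [hsign, map_prod, ← Finset.card_univ]
  exact Finset.prod_le_pow_card _ _ _ fun i _ => val_le_matVal v A _ _

theorem matVal_adjugate_le (A : Matrix (Fin 2) (Fin 2) R) :
    matVal v A.adjugate ≤ matVal v A := by
  rw [adjugate_fin_two]
  refine (matVal_le_iff v).2 fun i j => ?_
  fin_cases i <;> fin_cases j <;> simp [val_le_matVal]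

theorem vecVal_mul_val_det_le (r : Fin 2 → R) (A : Matrix (Fin 2) (Fin 2) R) :
    vecVal v r * v A.det ≤ vecVal v (r ᵥ* A) * matVal v A := by
  have hadj : (r ᵥ* A) ᵥ* A.adjugate = A.det • r := by
    rw [vecMul_vecMul, mul_adjugate, vecMul_smul, vecMul_one]
  calc vecVal v r * v A.det = vecVal v ((r ᵥ* A) ᵥ* A.adjugate) := by
        rw [hadj, vecVal_smul, mul_comm]
    _ ≤ vecVal v (r ᵥ* A) * matVal v A.adjugate := vecVal_vecMul_le v _ _
    _ ≤ vecVal v (r ᵥ* A) * matVal v A := mul_le_mul' le_rfl (matVal_adjugate_le v A)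

end MonoidWithZero

section GroupWithZero

variable {F Γ n : Type*} [Field F] [LinearOrderedCommGroupWithZero Γ] (v : Valuation F Γ)

theorem vecVal_row_pos [Fintype n] [DecidableEq n] (g : GL n F) (i : n) :
    0 < vecVal v (g.val i) := by
  refine zero_lt_iff.2 fun h => g.det_ne_zero (det_eq_zero_of_row_eq_zero i fun j => ?_)
  exact v.zero_iff.1 (le_zero_iff.1 (h ▸ val_le_vecVal v (g.val i) j))

theorem matVal_pos [Fintype n] [DecidableEq n] [Nonempty n] (g : GL n F) : 0 < matVal v g.val :=
  (vecVal_row_pos v g (Classical.arbitrary n)).trans_le (vecVal_le_matVal v _ _)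

theorem exists_vecVal_sub_smul_mul_le {A : Matrix (Fin 2) (Fin 2) F}
    (hpos : 0 < vecVal v (A 1)) (hle : vecVal v (A 0) ≤ vecVal v (A 1)) :
    ∃ b : F, v b ≤ 1 ∧ vecVal v (A 0 - b • A 1) * vecVal v (A 1) ≤ v A.det := by
  obtain ⟨j, hj⟩ := exists_vecVal_eq v (A 1)
  rw [hj] at hpos
  have hne : A 1 j ≠ 0 := v.pos_iff.1 hpos
  refine ⟨A 0 j / A 1 j, ?_, ?_⟩
  · rw [map_div₀]
    exact div_le_one_of_le₀ ((val_le_vecVal v (A 0) j).trans (hle.trans hj.le)) zero_le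
  · rw [hj, mul_comm, ← vecVal_smul]
    refine (vecVal_le_iff v).2 fun l => ?_
    have hl : (A 1 j • (A 0 - (A 0 j / A 1 j) • A 1)) l = A 1 j * A 0 l - A 0 j * A 1 l := by
      simp only [Pi.smul_apply, Pi.sub_apply, smul_eq_mul]
      field_simp
    rw [hl, det_fin_two]
    -- The entry vanishes if `l = j` and is `± det A` otherwise.
    fin_cases j <;> fin_cases l
    · simp [mul_comm]
    · exact (v.map_sub_swap _ _).trans_le (le_of_eq (by simp [mul_comm (A 0 1)]))
    · exact le_of_eq (by simp [mul_comm (A 1 1)])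
    · simp [mul_comm]

end GroupWithZero

end Norms

section Vertices

open Matrix

variable {F : Type*} [Field F]

theorem val_scalar_mul (a : Fˣ) (g : GL (Fin 2) F) :
    (GeneralLinearGroup.scalar (Fin 2) a * g).val = (a : F) • g.val := by
  rw [Units.val_mul, GeneralLinearGroup.coe_scalar, scalar_apply, ← smul_eq_diagonal_mul]

theorem scalar_mem_center (a : Fˣ) :
    GeneralLinearGroup.scalar (Fin 2) a ∈ Subgroup.center (GL (Fin 2) F) := by
  rw [GeneralLinearGroup.center_eq_range_scalar]
  exact ⟨a, rfl⟩

variable [ValuativeRel F]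

local notation "ν" => ValuativeRel.valuation F

theorem val_det_map_eq_one {n : Type*} [Fintype n] [DecidableEq n] (x : GL n 𝒪[F]) :
    ν (GeneralLinearGroup.map (algebraMap 𝒪[F] F) x).val.det = 1 := by
  have hdet : (GeneralLinearGroup.map (algebraMap 𝒪[F] F) x).val.det =
      algebraMap 𝒪[F] F x.val.det := (RingHom.map_det _ _).symm
  rw [hdet]
  exact (Valuation.integer.integers ν).isUnit_iff_valuation_eq_one.1
    (x.isUnit.map detMonoidHom)

theorem mem_K_of_matVal_le {g : GL (Fin 2) F} (h : matVal ν g.val ≤ 1) (hd : ν g.val.det = 1) :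
    g ∈ K F := by
  let A : Matrix (Fin 2) (Fin 2) 𝒪[F] :=
    Matrix.of fun i j => ⟨g.val i j, (matVal_le_iff ν).1 h i j⟩
  have hA : (algebraMap 𝒪[F] F).mapMatrix A = g.val := rfl
  have hdet : algebraMap 𝒪[F] F A.det = g.val.det := by rw [RingHom.map_det, hA]
  have hu : IsUnit A.det := by
    rw [(Valuation.integer.integers ν).isUnit_iff_valuation_eq_one, hdet, hd]
  exact ⟨GeneralLinearGroup.mk'' A hu, Units.ext hA⟩

theorem scalar_mem_KZ (a : Fˣ) : GeneralLinearGroup.scalar (Fin 2) a ∈ KZ F :=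
  Subgroup.mem_sup_right (scalar_mem_center a)

theorem mem_KZ_iff {g : GL (Fin 2) F} : g ∈ KZ F ↔ matVal ν g.val ^ 2 ≤ ν g.val.det := by
  constructor
  · intro hg
    obtain ⟨_, ⟨x, rfl⟩, z, hz, rfl⟩ := Subgroup.mem_sup_of_normal_right.1 hg
    rw [Subgroup.mem_center_iff.1 hz]
    rw [GeneralLinearGroup.center_eq_range_scalar] at hz
    obtain ⟨a, rfl⟩ := hz
    have hx : matVal ν (GeneralLinearGroup.map (algebraMap 𝒪[F] F) x).val ≤ 1 :=
      (matVal_le_iff ν).2 fun i j => (x.val i j).2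
    rw [val_scalar_mul, matVal_smul, det_smul, Fintype.card_fin, map_mul, val_det_map_eq_one,
      mul_one, map_pow]
    exact pow_le_pow_left' (mul_le_of_le_one_right' hx) 2
  · intro h
    obtain ⟨i, j, hij⟩ := exists_matVal_eq ν g.val
    have hne : g.val i j ≠ 0 := (ν).pos_iff.1 (hij ▸ matVal_pos ν g)
    let a := Units.mk0 (g.val i j) hne
    have hdet : ν g.val.det = ν a ^ 2 :=
      le_antisymm ((val_det_le ν g.val).trans_eq (by rw [hij, Fintype.card_fin]; rfl)) (hij ▸ h)
    have hva : ν (a : F) ≠ 0 := (ν).ne_zero_iff.2 hne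
    have hK : GeneralLinearGroup.scalar (Fin 2) a⁻¹ * g ∈ K F := by
      apply mem_K_of_matVal_le <;>
        rw [val_scalar_mul, Units.val_inv_eq_inv_val]
      · rw [matVal_smul, hij, map_inv₀]
        exact (inv_mul_cancel₀ hva).le
      · rw [det_smul, Fintype.card_fin, map_mul, hdet, map_pow, map_inv₀, ← mul_pow,
          inv_mul_cancel₀ hva, one_pow]
    have := mul_mem (scalar_mem_KZ a) (Subgroup.mem_sup_left hK : _ ∈ KZ F)
    rwa [← mul_assoc, ← map_mul, mul_inv_cancel, map_one, one_mul] at this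

theorem vecVal_vecMul_of_mem_KZ {h : GL (Fin 2) F} (hh : h ∈ KZ F) (r : Fin 2 → F) :
    vecVal ν (r ᵥ* h.val) = vecVal ν r * matVal ν h.val := by
  refine le_antisymm (vecVal_vecMul_le ν _ _) (le_of_mul_le_mul_right ?_ (matVal_pos ν h))
  refine le_trans ?_ (vecVal_mul_val_det_le ν r h.val)
  rw [mul_assoc, ← sq]
  exact mul_le_mul' le_rfl (mem_KZ_iff.1 hh)

variable (F) in
/-- The half-tree of the vertices `g * KZ` with `g` in `P⁺`. -/
def halfTree : Set (GL (Fin 2) F ⧸ KZ F) :=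
  (fun g : GL (Fin 2) F => (g : GL (Fin 2) F ⧸ KZ F)) '' PPlus F

theorem vecVal_le_of_mem_PPlus {g : GL (Fin 2) F} (hg : g ∈ PPlus F) :
    vecVal ν (g.val 0) ≤ vecVal ν (g.val 1) := by
  obtain ⟨a, b, -, hg⟩ := hg
  calc vecVal ν (g.val 0) ≤ 1 := by
        refine (vecVal_le_iff ν).2 fun i => ?_
        rw [hg]
        fin_cases i
        exacts [a.2, b.2]
    _ = ν (g.val 1 1) := by simp [hg]
    _ ≤ vecVal ν (g.val 1) := val_le_vecVal ν _ 1

theorem exists_mem_PPlus_mul_eq {g : GL (Fin 2) F}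
    (hg : vecVal ν (g.val 0) ≤ vecVal ν (g.val 1)) :
    ∃ t ∈ PPlus F, ∃ x ∈ KZ F, t * x = g := by
  obtain ⟨b, hb, hle⟩ := exists_vecVal_sub_smul_mul_le ν (vecVal_row_pos ν g 1) hg
  have hdet := (val_det_le ν g.val).trans_eq
    (congrArg (· ^ 2) (max_eq_right hg ▸ matVal_fin_two ν g.val))
  have hpos := vecVal_row_pos ν g 1
  generalize hγ : vecVal ν (g.val 1) = γ at hle hdet hpos
  obtain ⟨c, rfl⟩ := ValuativeRel.valuation_surjective γ
  have hc : c ≠ 0 := (ν).pos_iff.1 hpos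
  obtain ⟨a, hac⟩ : ∃ a, a * c ^ 2 = g.val.det := ⟨_, div_mul_cancel₀ _ (pow_ne_zero 2 hc)⟩
  have ha0 : a ≠ 0 := left_ne_zero_of_mul (hac.trans_ne g.det_ne_zero)
  have ha1 : ν a ≤ 1 := by
    rw [← hac, map_mul, map_pow] at hdet
    exact le_of_mul_le_mul_right (by rwa [one_mul]) (pow_pos hpos 2)
  let t : GL (Fin 2) F := GeneralLinearGroup.mkOfDetNeZero !![a, b; 0, 1] (by
    simpa [det_fin_two] using ha0)
  obtain ⟨x, rfl⟩ : ∃ x, g = t * x := ⟨t⁻¹ * g, by rw [mul_inv_cancel_left]⟩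
  have h0 : (t * x).val 0 = a • x.val 0 + b • x.val 1 := mul_row_fin_two t.val x.val 0
  have h1 : (t * x).val 1 = x.val 1 := by simp [t, mul_row_fin_two]
  have hd : (t * x).val.det = a * x.val.det := by
    rw [Units.val_mul, det_mul]
    simp [t, det_fin_two_of]
  refine ⟨t, ⟨⟨a, ha1⟩, ⟨b, hb⟩, fun h => ha0 (congrArg Subtype.val h), rfl⟩, x, ?_, rfl⟩
  rw [mem_KZ_iff, ← mul_left_cancel₀ ha0 (hac.trans hd), map_pow, matVal_fin_two]
  refine pow_le_pow_left' (max_le ?_ (h1 ▸ hγ).le) 2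
  rw [← hac, h0, h1, add_sub_cancel_right, vecVal_smul, map_mul, map_pow, sq, mul_assoc] at hle
  exact le_of_mul_le_mul_right (le_of_mul_le_mul_left hle ((ν).pos_iff.2 ha0)) hpos

theorem mk_mem_halfTree_iff {g : GL (Fin 2) F} :
    (g : GL (Fin 2) F ⧸ KZ F) ∈ halfTree F ↔ vecVal ν (g.val 0) ≤ vecVal ν (g.val 1) := by
  constructor
  · rintro ⟨t, ht, htg⟩
    obtain ⟨x, hx, rfl⟩ : ∃ x ∈ KZ F, t * x = g :=
      ⟨_, QuotientGroup.eq.1 htg, mul_inv_cancel_left _ _⟩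
    rw [Units.val_mul, mul_apply_eq_vecMul, mul_apply_eq_vecMul, vecVal_vecMul_of_mem_KZ hx,
      vecVal_vecMul_of_mem_KZ hx]
    exact mul_le_mul' (vecVal_le_of_mem_PPlus ht) le_rfl
  · intro hg
    obtain ⟨t, ht, x, hx, rfl⟩ := exists_mem_PPlus_mul_eq hg
    exact ⟨t, ht, QuotientGroup.eq.2 (by rwa [inv_mul_cancel_left])⟩

end Vertices

section Tree

open Matrix

variable {F : Type*} [Field F] [ValuativeRel F] {ϖ : 𝒪[F]}

local notation "ν" => ValuativeRel.valuation F

theorem val_lt_one_iff_mem_maximalIdeal {b : 𝒪[F]} :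
    ν (b : F) < 1 ↔ b ∈ IsLocalRing.maximalIdeal 𝒪[F] := by
  rw [IsLocalRing.mem_maximalIdeal, mem_nonunits_iff,
    (Valuation.integer.integers ν).isUnit_iff_valuation_eq_one]
  exact b.2.lt_iff_ne

theorem val_lt_one_of_irreducible (hϖ : Irreducible ϖ) : ν (ϖ : F) < 1 :=
  val_lt_one_iff_mem_maximalIdeal.2 hϖ.not_isUnit

theorem val_pos_of_irreducible (hϖ : Irreducible ϖ) : 0 < ν (ϖ : F) :=
  (ν).pos_iff.2 (by simpa using hϖ.ne_zero)

theorem residue_eq_iff_val_sub_lt_one {b c : 𝒪[F]} :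
    IsLocalRing.residue 𝒪[F] b = IsLocalRing.residue 𝒪[F] c ↔ ν ((b : F) - c) < 1 := by
  rw [← sub_eq_zero, ← map_sub, IsLocalRing.residue_eq_zero_iff,
    ← val_lt_one_iff_mem_maximalIdeal]
  rfl

/-- A representative in `𝒪` of an element of the residue field. -/
def residueLift (i : 𝓀[F]) : 𝒪[F] :=
  Function.surjInv IsLocalRing.residue_surjective i

theorem residue_residueLift (i : 𝓀[F]) : IsLocalRing.residue 𝒪[F] (residueLift i) = i :=
  Function.surjInv_eq _ i

theorem val_det_of_mem_KZ {h : GL (Fin 2) F} (hh : h ∈ KZ F) :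
    ν h.val.det = matVal ν h.val ^ 2 :=
  le_antisymm (val_det_le ν h.val) (mem_KZ_iff.1 hh)

theorem matVal_mul_of_mem_KZ {h : GL (Fin 2) F} (hh : h ∈ KZ F) (g : GL (Fin 2) F) :
    matVal ν (g * h).val = matVal ν g.val * matVal ν h.val := by
  rw [Units.val_mul, matVal_fin_two, matVal_fin_two, mul_apply_eq_vecMul, mul_apply_eq_vecMul,
    vecVal_vecMul_of_mem_KZ hh, vecVal_vecMul_of_mem_KZ hh]
  exact max_mul_mul_right _ _ _

/-- The vertices at distance at most `n` from the base vertex: by the theory of elementary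
divisors, the distance of `g * KZ` is the valuation of `det g` minus twice that of the largest
entry of `g`. -/
def ball (ϖ : 𝒪[F]) (n : ℕ) : Set (GL (Fin 2) F ⧸ KZ F) :=
  (fun g : GL (Fin 2) F => (g : GL (Fin 2) F ⧸ KZ F)) ''
    {g | matVal ν g.val ^ 2 * ν (ϖ : F) ^ n ≤ ν g.val.det}

theorem mk_mem_ball_iff {n : ℕ} {g : GL (Fin 2) F} :
    (g : GL (Fin 2) F ⧸ KZ F) ∈ ball ϖ n ↔ matVal ν g.val ^ 2 * ν (ϖ : F) ^ n ≤ ν g.val.det := by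
  refine ⟨?_, fun hg => ⟨g, hg, rfl⟩⟩
  rintro ⟨y, hy, hyg⟩
  obtain ⟨h, hh, rfl⟩ : ∃ h ∈ KZ F, y * h = g :=
    ⟨_, QuotientGroup.eq.1 hyg, mul_inv_cancel_left _ _⟩
  rw [matVal_mul_of_mem_KZ hh, Units.val_mul, det_mul, map_mul, val_det_of_mem_KZ hh, mul_pow,
    mul_right_comm]
  exact mul_le_mul' hy le_rfl

theorem ball_zero : ball ϖ 0 = {((1 : GL (Fin 2) F) : GL (Fin 2) F ⧸ KZ F)} := by
  ext x
  induction x using QuotientGroup.induction_on with | H g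
  rw [mk_mem_ball_iff, pow_zero, mul_one, ← mem_KZ_iff, Set.mem_singleton_iff, eq_comm,
    QuotientGroup.eq, inv_one, one_mul]

theorem ball_mono : Monotone (ball ϖ) := by
  intro m n hmn x hx
  induction x using QuotientGroup.induction_on with | H g
  rw [mk_mem_ball_iff] at hx ⊢
  exact (mul_le_mul' le_rfl (pow_le_pow_right_of_le_one' ϖ.2 hmn)).trans hx

theorem smul_mem_ball {m n : ℕ} {g : GL (Fin 2) F} {x : GL (Fin 2) F ⧸ KZ F}
    (hg : (g : GL (Fin 2) F ⧸ KZ F) ∈ ball ϖ m) (hx : x ∈ ball ϖ n) :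
    g • x ∈ ball ϖ (m + n) := by
  induction x using QuotientGroup.induction_on with | H x
  rw [mk_mem_ball_iff] at hg hx
  rw [MulAction.Quotient.smul_coe, smul_eq_mul, mk_mem_ball_iff, Units.val_mul, det_mul, map_mul]
  calc matVal ν (g.val * x.val) ^ 2 * ν (ϖ : F) ^ (m + n)
      ≤ (matVal ν g.val * matVal ν x.val) ^ 2 * ν (ϖ : F) ^ (m + n) :=
        mul_le_mul' (pow_le_pow_left' (matVal_mul_le ν _ _) 2) le_rfl
    _ = (matVal ν g.val ^ 2 * ν (ϖ : F) ^ m) * (matVal ν x.val ^ 2 * ν (ϖ : F) ^ n) := by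
        rw [mul_pow, pow_add, mul_mul_mul_comm]
    _ ≤ ν g.val.det * ν x.val.det := mul_le_mul' hg hx

theorem Pi_mul_row_zero (hϖ : Irreducible ϖ) (y : GL (Fin 2) F) :
    (Pi ϖ hϖ * y).val 0 = y.val 1 := by
  simp [Pi, mul_row_fin_two]

theorem Pi_mul_row_one (hϖ : Irreducible ϖ) (y : GL (Fin 2) F) :
    (Pi ϖ hϖ * y).val 1 = (ϖ : F) • y.val 0 := by
  simp [Pi, mul_row_fin_two]

theorem val_det_Pi_mul (hϖ : Irreducible ϖ) (y : GL (Fin 2) F) :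
    ν (Pi ϖ hϖ * y).val.det = ν (ϖ : F) * ν y.val.det := by
  rw [Units.val_mul, det_mul, map_mul]
  simp [Pi, det_fin_two_of]

theorem Pi_mul_Pi_mem_KZ (hϖ : Irreducible ϖ) : Pi ϖ hϖ * Pi ϖ hϖ ∈ KZ F := by
  have hsq : Pi ϖ hϖ * Pi ϖ hϖ =
      GeneralLinearGroup.scalar (Fin 2) (Units.mk0 (ϖ : F) (by simpa using hϖ.ne_zero)) := by
    ext i j
    fin_cases i <;> fin_cases j <;> simp [Pi]
  exact hsq ▸ scalar_mem_KZ _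

theorem mk_Pi_mem_ball (hϖ : Irreducible ϖ) : (Pi ϖ hϖ : GL (Fin 2) F ⧸ KZ F) ∈ ball ϖ 1 := by
  have hle : matVal ν (Pi ϖ hϖ).val ≤ 1 := by
    refine (matVal_le_iff ν).2 fun i j => ?_
    fin_cases i <;> fin_cases j <;> simp [Pi, (Valuation.mem_integer_iff ν ϖ.1).1 ϖ.2]
  have hdet := val_det_Pi_mul hϖ 1
  rw [mul_one, Units.val_one, det_one, map_one, mul_one] at hdet
  rw [mk_mem_ball_iff, hdet, pow_one]
  exact mul_le_of_le_one_left' (pow_le_one' hle 2)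

/-- The matrix `(b 1; 1 0)`. Its inverse replaces the rows `r₀, r₁` of a matrix by
`r₁, r₀ - b r₁`. -/
def branch {R : Type*} [CommRing R] (b : R) : GL (Fin 2) R where
  val := !![b, 1; 1, 0]
  inv := !![0, 1; 1, -b]
  val_inv := by simp [one_fin_two]
  inv_val := by simp [one_fin_two]

theorem mk_mem_branch_smul_iff {b : 𝒪[F]} {g : GL (Fin 2) F} :
    (g : GL (Fin 2) F ⧸ KZ F) ∈
        GeneralLinearGroup.map (algebraMap 𝒪[F] F) (branch b) • (halfTree F)ᶜ ↔
      vecVal ν (g.val 0 - (b : F) • g.val 1) < vecVal ν (g.val 1) := by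
  have hinv : ((GeneralLinearGroup.map (algebraMap 𝒪[F] F) (branch b))⁻¹).val =
      !![0, 1; 1, -(b : F)] := by
    rw [← map_inv]
    ext i j
    fin_cases i <;> fin_cases j <;> rfl
  rw [Set.mem_smul_set_iff_inv_smul_mem, MulAction.Quotient.smul_coe, smul_eq_mul,
    Set.mem_compl_iff, mk_mem_halfTree_iff, not_le, Units.val_mul, hinv, mul_row_fin_two,
    mul_row_fin_two]
  simp [sub_eq_add_neg]

theorem val_sub_lt_one_of_vecVal_lt {b c : F} {r s : Fin 2 → F}
    (hb : vecVal ν (r - b • s) < vecVal ν s) (hc : vecVal ν (r - c • s) < vecVal ν s) :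
    ν (b - c) < 1 := by
  have hsub : (b - c) • s = (r - c • s) + (-1 : F) • (r - b • s) := by
    module
  have hlt : ν (b - c) * vecVal ν s < 1 * vecVal ν s := by
    rw [← vecVal_smul, hsub, one_mul]
    refine (vecVal_add_le ν _ _).trans_lt (max_lt hc ?_)
    rwa [vecVal_smul, (ν).map_neg, map_one, one_mul]
  exact lt_of_mul_lt_mul_right hlt zero_le

theorem vecVal_sub_smul_lt_of_val_sub_lt_one {b c : F} {r s : Fin 2 → F}
    (hb : vecVal ν (r - b • s) < vecVal ν s) (hbc : ν (b - c) < 1) :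
    vecVal ν (r - c • s) < vecVal ν s := by
  have hsub : r - c • s = (r - b • s) + (b - c) • s := by
    module
  rw [hsub]
  refine (vecVal_add_le ν _ _).trans_lt (max_lt hb ?_)
  rw [vecVal_smul]
  exact mul_lt_of_lt_one_left (zero_le.trans_lt hb) hbc

theorem exists_vecVal_sub_smul_lt {g : GL (Fin 2) F} (hgP : ↑g ∈ halfTree F) (hg : g ∉ KZ F) :
    ∃ b : 𝒪[F], vecVal ν (g.val 0 - (b : F) • g.val 1) < vecVal ν (g.val 1) := by
  rw [mk_mem_halfTree_iff] at hgP
  obtain ⟨b, hb, hle⟩ := exists_vecVal_sub_smul_mul_le ν (vecVal_row_pos ν g 1) hgP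
  rw [mem_KZ_iff, matVal_fin_two, max_eq_right hgP, sq, not_le] at hg
  exact ⟨⟨b, hb⟩, lt_of_mul_lt_mul_right (hle.trans_lt hg) zero_le⟩

theorem halfTree_subset_branches : halfTree F ⊆ insert ((1 : GL (Fin 2) F) : GL (Fin 2) F ⧸ KZ F)
    (⋃ i : 𝓀[F], GeneralLinearGroup.map (algebraMap 𝒪[F] F) (branch (residueLift i)) •
      (halfTree F)ᶜ) := by
  intro x hx
  induction x using QuotientGroup.induction_on with | H g
  rw [Set.mem_insert_iff, or_iff_not_imp_left, eq_comm, QuotientGroup.eq, inv_one, one_mul]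
  intro hg
  obtain ⟨b, hb⟩ := exists_vecVal_sub_smul_lt hx hg
  refine Set.mem_iUnion.2 ⟨IsLocalRing.residue 𝒪[F] b, mk_mem_branch_smul_iff.2 ?_⟩
  refine vecVal_sub_smul_lt_of_val_sub_lt_one hb (residue_eq_iff_val_sub_lt_one.1 ?_)
  rw [residue_residueLift]

theorem disjoint_branches : Pairwise (Function.onFun Disjoint fun i : 𝓀[F] =>
    GeneralLinearGroup.map (algebraMap 𝒪[F] F) (branch (residueLift i)) • (halfTree F)ᶜ) := by
  refine fun i j hij => Set.disjoint_left.2 fun x hi hj => hij ?_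
  induction x using QuotientGroup.induction_on with | H g
  rw [mk_mem_branch_smul_iff] at hi hj
  rw [← residue_residueLift i, ← residue_residueLift j, residue_eq_iff_val_sub_lt_one]
  exact val_sub_lt_one_of_vecVal_lt hi hj

theorem smul_ball_subset_halfTree {m : ℕ} {g : GL (Fin 2) F}
    (hg : (g : GL (Fin 2) F ⧸ KZ F) ∈ halfTree F) (hgm : (g : GL (Fin 2) F ⧸ KZ F) ∉ ball ϖ m) :
    g • ball ϖ m ⊆ halfTree F := by
  rintro _ ⟨_, ⟨x, hx, rfl⟩, rfl⟩
  rw [mk_mem_halfTree_iff] at hg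
  rw [mk_mem_ball_iff, matVal_fin_two, max_eq_right hg, not_le] at hgm
  obtain ⟨b, hb, hle⟩ := exists_vecVal_sub_smul_mul_le ν (vecVal_row_pos ν g 1) hg
  have hshort : vecVal ν (g.val 0 - b • g.val 1) ≤ vecVal ν (g.val 1) * ν (ϖ : F) ^ m := by
    refine le_of_mul_le_mul_right (hle.trans (hgm.le.trans_eq ?_)) (vecVal_row_pos ν g 1)
    rw [sq, mul_right_comm]
  have hlong : vecVal ν (g.val 1) * ν (ϖ : F) ^ m * matVal ν x.val ≤
      vecVal ν (g.val 1 ᵥ* x.val) := by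
    refine le_of_mul_le_mul_right ?_ (matVal_pos ν x)
    calc vecVal ν (g.val 1) * ν (ϖ : F) ^ m * matVal ν x.val * matVal ν x.val
        = vecVal ν (g.val 1) * (matVal ν x.val ^ 2 * ν (ϖ : F) ^ m) := by rw [sq]; ac_rfl
      _ ≤ vecVal ν (g.val 1) * ν x.val.det := mul_le_mul' le_rfl hx
      _ ≤ _ := vecVal_mul_val_det_le ν _ _
  have hsplit : g.val 0 ᵥ* x.val = (g.val 0 - b • g.val 1) ᵥ* x.val + b • (g.val 1 ᵥ* x.val) := by
    rw [sub_vecMul, smul_vecMul, sub_add_cancel]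
  change ((g * x : GL (Fin 2) F) : GL (Fin 2) F ⧸ KZ F) ∈ halfTree F
  rw [mk_mem_halfTree_iff, Units.val_mul, mul_apply_eq_vecMul, mul_apply_eq_vecMul, hsplit]
  refine (vecVal_add_le ν _ _).trans (max_le ?_ ?_)
  · exact (vecVal_vecMul_le ν _ _).trans ((mul_le_mul' hshort le_rfl).trans hlong)
  · rw [vecVal_smul]
    exact mul_le_of_le_one_left' hb

variable [IsDiscreteValuationRing 𝒪[F]]

theorem lt_iff_le_val_mul (hϖ : Irreducible ϖ) {a b : ValuativeRel.ValueGroupWithZero F}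
    (hb : 0 < b) : a < b ↔ a ≤ ν (ϖ : F) * b := by
  refine ⟨fun h => ?_, fun h =>
    h.trans_lt (mul_lt_of_lt_one_left hb (val_lt_one_of_irreducible hϖ))⟩
  obtain ⟨x, hx⟩ := ValuativeRel.valuation_surjective (a / b)
  have hx1 : ν x < 1 := by
    rw [hx]
    exact (div_lt_one₀ hb).2 h
  have hmem : (⟨x, hx1.le⟩ : 𝒪[F]) ∈ IsLocalRing.maximalIdeal 𝒪[F] :=
    val_lt_one_iff_mem_maximalIdeal.1 hx1
  rw [hϖ.maximalIdeal_eq, Ideal.mem_span_singleton,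
    (Valuation.integer.integers ν).dvd_iff_le] at hmem
  rw [← div_le_iff₀ hb, ← hx]
  exact hmem

theorem exists_val_pow_le (hϖ : Irreducible ϖ) {a : ValuativeRel.ValueGroupWithZero F}
    (ha : 0 < a) : ∃ n : ℕ, ν (ϖ : F) ^ n ≤ a := by
  rcases le_total 1 a with h1 | h1
  · exact ⟨0, by rwa [pow_zero]⟩
  obtain ⟨x, rfl⟩ := ValuativeRel.valuation_surjective a
  have hx : (⟨x, h1⟩ : 𝒪[F]) ≠ 0 := fun h => (ν).pos_iff.1 ha (congrArg Subtype.val h)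
  obtain ⟨n, hn⟩ := IsDiscreteValuationRing.associated_pow_irreducible hx hϖ
  refine ⟨n, ?_⟩
  rw [← map_pow]
  exact (Valuation.integer.integers ν).dvd_iff_le.1 hn.dvd

theorem exists_mem_ball (hϖ : Irreducible ϖ) (x : GL (Fin 2) F ⧸ KZ F) : ∃ n, x ∈ ball ϖ n := by
  induction x using QuotientGroup.induction_on with | H g
  have h2 : 0 < matVal ν g.val ^ 2 := pow_pos (matVal_pos ν g) 2
  obtain ⟨n, hn⟩ := exists_val_pow_le hϖ (div_pos ((ν).pos_iff.2 g.det_ne_zero) h2)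
  exact ⟨n, mk_mem_ball_iff.2 ((le_div_iff₀' h2).1 hn)⟩

theorem isBallFiltration_ball (hϖ : Irreducible ϖ) : IsBallFiltration (KZ F) (ball ϖ) where
  zero := ball_zero
  mono := ball_mono
  smul_mem := smul_mem_ball
  exists_mem := exists_mem_ball hϖ

theorem mk_Pi_mul_mem_halfTree_iff (hϖ : Irreducible ϖ) {y : GL (Fin 2) F} :
    ((Pi ϖ hϖ * y : GL (Fin 2) F) : GL (Fin 2) F ⧸ KZ F) ∈ halfTree F ↔
      (y : GL (Fin 2) F ⧸ KZ F) ∉ halfTree F := by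
  rw [mk_mem_halfTree_iff, mk_mem_halfTree_iff, Pi_mul_row_zero, Pi_mul_row_one, vecVal_smul,
    not_le, lt_iff_le_val_mul hϖ (vecVal_row_pos ν y 0)]

theorem Pi_smul_halfTree (hϖ : Irreducible ϖ) : Pi ϖ hϖ • halfTree F = (halfTree F)ᶜ := by
  ext x
  induction x using QuotientGroup.induction_on with | H g
  obtain ⟨y, rfl⟩ : ∃ y, Pi ϖ hϖ * y = g := ⟨_, mul_inv_cancel_left _ _⟩
  rw [Set.mem_smul_set_iff_inv_smul_mem, MulAction.Quotient.smul_coe, smul_eq_mul,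
    inv_mul_cancel_left, Set.mem_compl_iff, mk_Pi_mul_mem_halfTree_iff, not_not]

theorem Pi_inv_smul_mem_ball (hϖ : Irreducible ϖ) {n : ℕ} {x : GL (Fin 2) F ⧸ KZ F}
    (hxP : x ∉ halfTree F) (hx : x ∈ ball ϖ (n + 1)) : (Pi ϖ hϖ)⁻¹ • x ∈ ball ϖ n := by
  induction x using QuotientGroup.induction_on with | H g
  obtain ⟨y, rfl⟩ : ∃ y, Pi ϖ hϖ * y = g := ⟨_, mul_inv_cancel_left _ _⟩
  rw [mk_Pi_mul_mem_halfTree_iff, not_not, mk_mem_halfTree_iff] at hxP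
  rw [mk_mem_ball_iff, val_det_Pi_mul, pow_succ' _ n, mul_left_comm] at hx
  have hle : matVal ν y.val ≤ matVal ν (Pi ϖ hϖ * y).val := by
    rw [matVal_fin_two, max_eq_right hxP, ← Pi_mul_row_zero hϖ]
    exact vecVal_le_matVal ν _ 0
  rw [MulAction.Quotient.smul_coe, smul_eq_mul, inv_mul_cancel_left, mk_mem_ball_iff]
  exact (mul_le_mul' (pow_le_pow_left' hle 2) le_rfl).trans
    (le_of_mul_le_mul_left hx (val_pos_of_irreducible hϖ))

theorem isHalfTree_halfTree (hϖ : Irreducible ϖ) :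
    IsHalfTree (ball ϖ) (halfTree F) (Pi ϖ hϖ) fun i : 𝓀[F] =>
      GeneralLinearGroup.map (algebraMap 𝒪[F] F) (branch (residueLift i)) where
  toIsBallFiltration := isBallFiltration_ball hϖ
  one_mem := ⟨1, ⟨1, 0, one_ne_zero, by simp [one_fin_two]⟩, rfl⟩
  flip_smul := Pi_smul_halfTree hϖ
  flip_mul_flip_mem := Pi_mul_Pi_mem_KZ hϖ
  flip_mem_ball := mk_Pi_mem_ball hϖ
  flip_inv_smul_mem_of_mem_succ := Pi_inv_smul_mem_ball hϖ
  mem _ := Subgroup.mem_sup_left ⟨_, rfl⟩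
  subset_branches := halfTree_subset_branches
  disjoint_branches := disjoint_branches
  smul_ball_subset := smul_ball_subset_halfTree

end Tree

section FiniteModules

theorem isMaximal_annihilator_of_smul_top {A V : Type*} [CommRing A] [AddCommGroup V] [Module A V]
    [Module.Finite A V] [Nontrivial V]
    (h : ∀ I : Ideal A, I • (⊤ : Submodule A V) = ⊥ ∨ I • (⊤ : Submodule A V) = ⊤) :
    (Module.annihilator A V).IsMaximal := by
  have hne : Module.annihilator A V ≠ ⊤ := fun h =>
    not_subsingleton V (Module.annihilator_eq_top_iff.1 h)
  obtain ⟨m, hm, hle⟩ := Ideal.exists_le_maximal _ hne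
  suffices m ≤ Module.annihilator A V from le_antisymm hle this ▸ hm
  refine (h m).elim (fun h => ?_) fun h => ?_
  · rwa [← Submodule.annihilator_top, Submodule.le_annihilator_iff]
  · obtain ⟨r, hr, hr0⟩ := Submodule.exists_sub_one_mem_and_smul_eq_zero_of_fg_of_le_smul m
      (⊤ : Submodule A V) Module.Finite.fg_top h.ge
    have hrm : r ∈ m := hle (Module.mem_annihilator.2 fun v => hr0 v trivial)
    exact absurd (by simpa using sub_mem hrm hr) ((Ideal.ne_top_iff_one m).1 hm.ne_top)

theorem finiteDimensional_of_isMaximal_annihilator (k : Type*) {A V : Type*} [Field k] [CommRing A]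
    [Algebra k A] [Algebra.FiniteType k A] [AddCommGroup V] [Module k V] [Module A V]
    [IsScalarTower k A V] [Module.Finite A V] (h : (Module.annihilator A V).IsMaximal) :
    FiniteDimensional k V := by
  let _ : Field (A ⧸ Module.annihilator A V) := Ideal.Quotient.field _
  let _ : Module (A ⧸ Module.annihilator A V) V := Module.quotientAnnihilator
  have hA : IsScalarTower A (A ⧸ Module.annihilator A V) V := ⟨fun a b v => by
    obtain ⟨b, rfl⟩ := Ideal.Quotient.mk_surjective b
    exact mul_smul a b v⟩
  have hk : IsScalarTower k (A ⧸ Module.annihilator A V) V := IsScalarTower.of_algebraMap_smul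
    fun c v => algebraMap_smul A c v
  have := finite_of_finite_type_of_isJacobsonRing k (A ⧸ Module.annihilator A V)
  have := Module.Finite.of_restrictScalars_finite A (A ⧸ Module.annihilator A V) V
  exact Module.Finite.trans (A ⧸ Module.annihilator A V) V

end FiniteModules

section IrreducibleRepresentations

variable {k G V : Type*} [Field k] [Group G] [AddCommGroup V] [Module k V]
  {ρ : Representation k G V}

theorem span_orbit_eq_top (hρ : ρ.IsIrreducible) {v : V} (hv : v ≠ 0) :
    Submodule.span k (Set.range fun g => ρ g v) = ⊤ := by
  let N : Subrepresentation ρ :=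
    { toSubmodule := Submodule.span k (Set.range fun g => ρ g v)
      apply_mem_toSubmodule := fun g x hx => by
        refine Submodule.span_induction (p := fun x _ => ρ g x ∈ Submodule.span k _) ?_ ?_ ?_ ?_ hx
        · rintro _ ⟨g', rfl⟩
          exact Submodule.subset_span ⟨g * g', by simp only [map_mul, Module.End.mul_apply]⟩
        · rw [map_zero]
          exact zero_mem _
        · intro x y _ _ hx hy
          rw [map_add]
          exact add_mem hx hy
        · intro c x _ hx
          rw [map_smul]
          exact Submodule.smul_mem _ c hx }
  have hvN : v ∈ N.toSubmodule := Submodule.subset_span ⟨1, by simp⟩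
  refine congrArg Subrepresentation.toSubmodule (hρ.eq_bot_or_eq_top N |>.resolve_left fun h => ?_)
  rw [h] at hvN
  exact hv hvN

open scoped IsMulCommutative in
theorem finiteDimensional_of_finite_subalgebra (hρ : ρ.IsIrreducible)
    {A : Subalgebra k (Module.End k V)} [IsMulCommutative A] [Module.Finite A V] (hA : A.FG)
    (hAρ : A ≤ Subalgebra.centralizer k (Set.range ρ)) : FiniteDimensional k V := by
  have := (Subalgebra.fg_iff_finiteType A).1 hA
  cases subsingleton_or_nontrivial V
  · infer_instance
  refine finiteDimensional_of_isMaximal_annihilator k (A := A)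
    (isMaximal_annihilator_of_smul_top fun I => ?_)
  let N : Subrepresentation ρ :=
    { toSubmodule := (I • (⊤ : Submodule A V)).restrictScalars k
      apply_mem_toSubmodule := fun g v hv => by
        have hv : v ∈ I • (⊤ : Submodule A V) := hv
        change ρ g v ∈ I • (⊤ : Submodule A V)
        refine Submodule.smul_induction_on hv (fun a ha x _ => ?_) fun x y hx hy => ?_
        · have hga : ρ g * a = a * ρ g := (Subalgebra.mem_centralizer_iff k).1 (hAρ a.2) _ ⟨g, rfl⟩
          have hgx : ρ g (a • x) = a • ρ g x := LinearMap.congr_fun hga x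
          rw [hgx]
          exact Submodule.smul_mem_smul ha trivial
        · rw [map_add]
          exact add_mem hx hy }
  rcases hρ.eq_bot_or_eq_top N with h | h
  · exact .inl (SetLike.ext fun v => (SetLike.ext_iff.1 h v :))
  · exact .inr (SetLike.ext fun v => (SetLike.ext_iff.1 h v :))

theorem IsSmooth.isLocallyConstant_apply [TopologicalSpace G] [ContinuousMul G] (hρ : IsSmooth ρ)
    (v : V) : IsLocallyConstant fun g => ρ g v := by
  obtain ⟨U, hU, hUv⟩ := hρ v
  refine (IsLocallyConstant.iff_exists_open _).2 fun g =>
    ⟨(g⁻¹ * ·) ⁻¹' U, hU.preimage (continuous_const_mul g⁻¹), by simp, fun g' hg' => ?_⟩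
  rw [← mul_inv_cancel_left g g', map_mul, Module.End.mul_apply, hUv _ hg']

theorem zpow_mem_adjoin (ρ : Representation k G V) (z : G) (n : ℤ) :
    ρ (z ^ n) ∈ Algebra.adjoin k {ρ z, ρ z⁻¹} := by
  obtain ⟨m, rfl | rfl⟩ := n.eq_nat_or_neg
  · rw [zpow_natCast, map_pow]
    exact pow_mem (Algebra.subset_adjoin (.inl rfl)) m
  · rw [zpow_neg, zpow_natCast, ← inv_pow, map_pow]
    exact pow_mem (Algebra.subset_adjoin (.inr rfl)) m

theorem isMulCommutative_adjoin (ρ : Representation k G V) (z : G) :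
    IsMulCommutative (Algebra.adjoin k {ρ z, ρ z⁻¹}) := by
  refine Algebra.isMulCommutative_adjoin k ?_
  have h : ρ z * ρ z⁻¹ = ρ z⁻¹ * ρ z := by simp only [← map_mul, mul_inv_cancel, inv_mul_cancel]
  rintro _ (rfl | rfl) _ (rfl | rfl)
  exacts [rfl, h, h.symm, rfl]

theorem adjoin_le_centralizer (ρ : Representation k G V) {z : G} (hz : z ∈ Subgroup.center G) :
    Algebra.adjoin k {ρ z, ρ z⁻¹} ≤ Subalgebra.centralizer k (Set.range ρ) := by
  refine Algebra.adjoin_le ?_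
  rintro _ (rfl | rfl) _ ⟨g, rfl⟩ <;> rw [← map_mul, ← map_mul]
  · rw [Subgroup.mem_center_iff.1 hz g]
  · rw [Subgroup.mem_center_iff.1 (inv_mem hz) g]

theorem finiteDimensional_of_finite_image_of_zpow_mul_mem (hρ : ρ.IsIrreducible) {v : V}
    (hv : v ≠ 0) {z : G} (hz : z ∈ Subgroup.center G) {C : Set G}
    (hC : ((fun g => ρ g v) '' C).Finite) (hCz : ∀ g, ∃ n : ℤ, z ^ n * g ∈ C) :
    FiniteDimensional k V := by
  let A : Subalgebra k (Module.End k V) := Algebra.adjoin k {ρ z, ρ z⁻¹}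
  have hle : Submodule.span k (Set.range fun g => ρ g v) ≤
      (Submodule.span A ((fun g => ρ g v) '' C)).restrictScalars k := by
    refine Submodule.span_le.2 (Set.range_subset_iff.2 fun g => ?_)
    obtain ⟨n, hn⟩ := hCz g
    have hg : ρ g v = (⟨_, zpow_mem_adjoin ρ z (-n)⟩ : A) • ρ (z ^ n * g) v := by
      change _ = ρ (z ^ (-n)) (ρ (z ^ n * g) v)
      rw [← Module.End.mul_apply, ← map_mul, zpow_neg, inv_mul_cancel_left]
    rw [hg]
    exact Submodule.smul_mem (Submodule.span A _) _ (Submodule.subset_span ⟨_, hn, rfl⟩)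
  have : Module.Finite A V := by
    refine ⟨⟨hC.toFinset, eq_top_iff.2 fun x _ => ?_⟩⟩
    rw [Set.Finite.coe_toFinset]
    exact hle (span_orbit_eq_top hρ hv ▸ trivial)
  have : IsMulCommutative A := isMulCommutative_adjoin ρ z
  exact finiteDimensional_of_finite_subalgebra hρ (Subalgebra.fg_def.2 ⟨_, Set.toFinite _, rfl⟩)
    (adjoin_le_centralizer ρ hz)

theorem IsSmooth.finiteDimensional_of_compact_mod_zpowers [TopologicalSpace G] [ContinuousMul G]
    (hsm : IsSmooth ρ) (hρ : ρ.IsIrreducible) {z : G} (hz : z ∈ Subgroup.center G) {C : Set G}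
    (hC : IsCompact C) (hCz : ∀ g, ∃ n : ℤ, z ^ n * g ∈ C) : FiniteDimensional k V := by
  cases subsingleton_or_nontrivial V
  · infer_instance
  obtain ⟨v, hv⟩ := exists_ne (0 : V)
  exact finiteDimensional_of_finite_image_of_zpow_mul_mem hρ hv hz
    (finite_image_of_isLocallyConstant (hsm.isLocallyConstant_apply v) hC) hCz

end IrreducibleRepresentations

section Weights

open Matrix

variable {F : Type*} [Field F] [ValuativeRel F]

theorem scalar_mem_K (u : 𝒪[F]ˣ) :
    GeneralLinearGroup.scalar (Fin 2) (Units.map (algebraMap 𝒪[F] F : 𝒪[F] →* F) u) ∈ K F :=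
  ⟨GeneralLinearGroup.scalar (Fin 2) u, by ext i j; fin_cases i <;> fin_cases j <;> simp⟩

variable [TopologicalSpace F] [IsNonarchimedeanLocalField F]

theorem exists_scalar_zpow_mul_mem_K {ϖ : 𝒪[F]} (hϖ : Irreducible ϖ) {a : Fˣ} (ha : (a : F) = ϖ)
    {g : GL (Fin 2) F} (hg : g ∈ KZ F) :
    ∃ n : ℤ, GeneralLinearGroup.scalar (Fin 2) a ^ n * g ∈ K F := by
  obtain ⟨x, hx, y, hy, rfl⟩ := Subgroup.mem_sup_of_normal_right.1 hg
  rw [GeneralLinearGroup.center_eq_range_scalar] at hy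
  obtain ⟨c, rfl⟩ := hy
  obtain ⟨n, u, hc⟩ :=
    IsDiscreteValuationRing.exists_units_eq_smul_zpow_of_irreducible hϖ c.ne_zero
  have hcu : c = a ^ n * Units.map (algebraMap 𝒪[F] F : 𝒪[F] →* F) u := Units.ext <| by
    rw [hc, Units.val_mul, Units.val_zpow_eq_zpow_val, ha, mul_comm]
    rfl
  refine ⟨-n, ?_⟩
  rw [(Subgroup.mem_center_iff.1 (scalar_mem_center c) x), hcu, map_mul, map_zpow, mul_assoc,
    _root_.zpow_neg, inv_mul_cancel_left]
  exact mul_mem (scalar_mem_K u) hx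

theorem isCompact_K : IsCompact (K F : Set (GL (Fin 2) F)) := by
  have : T1Space F := by
    let := IsTopologicalAddGroup.rightUniformSpace F
    have := isUniformAddGroup_of_addCommGroup (G := F)
    infer_instance
  have : T1Space (Matrix (Fin 2) (Fin 2) 𝒪[F]) := inferInstanceAs (T1Space (Fin 2 → Fin 2 → 𝒪[F]))
  have : CompactSpace (Matrix (Fin 2) (Fin 2) 𝒪[F]) :=
    inferInstanceAs (CompactSpace (Fin 2 → Fin 2 → 𝒪[F]))
  have : CompactSpace (GL (Fin 2) 𝒪[F]) :=
    inferInstanceAs (CompactSpace (Matrix (Fin 2) (Fin 2) 𝒪[F])ˣ)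
  exact isCompact_range (Continuous.units_map _ (continuous_id.matrix_map continuous_subtype_val))

variable {k V : Type*} [Field k] [AddCommGroup V] [Module k V]

theorem IsWeight.finiteDimensional {σ : Representation k (KZ F) V} (hσ : IsWeight σ) :
    FiniteDimensional k V := by
  obtain ⟨ϖ, hϖ⟩ := IsDiscreteValuationRing.exists_irreducible 𝒪[F]
  let a : Fˣ := Units.mk0 (ϖ : F) (by simpa using hϖ.ne_zero)
  let z : KZ F := ⟨GeneralLinearGroup.scalar (Fin 2) a, scalar_mem_KZ a⟩
  have hz : z ∈ Subgroup.center (KZ F) := Subgroup.mem_center_iff.2 fun g =>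
    Subtype.ext (Subgroup.mem_center_iff.1 (scalar_mem_center a) g)
  have hC : IsCompact {g : KZ F | (g : GL (Fin 2) F) ∈ K F} :=
    Topology.IsInducing.subtypeVal.isCompact_preimage' isCompact_K
      (Subtype.range_coe ▸ (le_sup_left : K F ≤ KZ F))
  exact hσ.smooth.finiteDimensional_of_compact_mod_zpowers hσ.irreducible hz hC
    fun g => exists_scalar_zpow_mul_mem_K hϖ rfl g.2

end Weights

end ModpGL2

end

theorem mainTheorem8_general
    {F : Type*} [Field F] [ValuativeRel F] [TopologicalSpace F] [IsNonarchimedeanLocalField F]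
    (ϖ : 𝒪[F]) (hϖ : Irreducible ϖ)
    {k : Type*} [Field k] {V : Type*} [AddCommGroup V] [Module k V] [FiniteDimensional k V]
    (σ : Representation k (ModpGL2.KZ F) V)
    {W : Type*} [AddCommGroup W] [Module k W] (π : Representation k (GL (Fin 2) F) W)
    (φ : Representation.IntertwiningMap (ModpGL2.cInd (ModpGL2.KZ F) σ) π) :
    FiniteDimensional k (ModpGL2.D1 ϖ hϖ φ) ↔ (ModpGL2.R φ).FG := by
  have hplus : ModpGL2.IPlus σ = ModpGL2.supportedOn σ (ModpGL2.halfTree F) :=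
    ModpGL2.span_bracket_eq_supportedOn ModpGL2.isOpen_KZ (ModpGL2.PPlus F)
  have hminus : ModpGL2.IMinus ϖ hϖ σ = ModpGL2.supportedOn σ (ModpGL2.halfTree F)ᶜ := by
    rw [ModpGL2.IMinus, hplus, ModpGL2.map_cInd_supportedOn, ModpGL2.Pi_smul_halfTree]
  have hD1 : ModpGL2.D1 ϖ hϖ φ = ModpGL2.edgeSpace φ (ModpGL2.halfTree F) := by
    rw [ModpGL2.D1, hplus, hminus, ModpGL2.edgeSpace]
  rw [hD1]
  exact (ModpGL2.isHalfTree_halfTree hϖ).finiteDimensional_edgeSpace_iff ModpGL2.isOpen_KZ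

theorem mainTheorem8 (p : ℕ) [Fact p.Prime]
    {F : Type*} [Field F] [ValuativeRel F] [TopologicalSpace F] [IsNonarchimedeanLocalField F]
    [CharP 𝓀[F] p] (ϖ : 𝒪[F]) (hϖ : Irreducible ϖ)
    {k : Type*} [Field k] [IsAlgClosed k] [CharP k p]
    {V : Type*} [AddCommGroup V] [Module k V]
    (σ : Representation k (ModpGL2.KZ F) V) (hσ : ModpGL2.IsWeight σ)
    {W : Type*} [AddCommGroup W] [Module k W] (π : Representation k (GL (Fin 2) F) W)
    (φ : Representation.IntertwiningMap (ModpGL2.cInd (ModpGL2.KZ F) σ) π)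
    (hφ : Function.Surjective φ) (hR : ModpGL2.R φ ≠ ⊥) :
    FiniteDimensional k (ModpGL2.D1 ϖ hϖ φ) ↔ (ModpGL2.R φ).FG := by
  have := hσ.finiteDimensional
  exact mainTheorem8_general ϖ hϖ σ π φ
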